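/- Let $\alpha<\beta$, let $A=\mathrm{diag}(a_1,\dots,a_n)$ with $a_1,\dots,a_n$ real and non-zero, and let $S$ be an invertible complex $n\times n$ matrix. Assume that the two principal submatrices $(S_{ij})_{a_i>0,\,a_j>0}$ and $(S_{ij})_{a_i<0,\,a_j<0}$ are invertible (an empty matrix counts as invertible). This holds automatically when all the $a_i$ have the same sign, since then one submatrix is $S$ and the other is empty; in particular it holds when $A=I$. Let $L$ be the operator in $L^2((\alpha,\beta),\mathbf C^n)$ given by $Lf=Af'$ with domain $$\mathrm{Dom}(L)=\{f\in W^{1,2}((\alpha,\beta),\mathbf C^n): f(\beta)=Sf(\alpha)\},$$ where $f'$ is the weak derivative and the boundary values are those of the continuous representative of $f$ on $[\alpha,\beta]$. Then $L$ is the generator of a strongly continuous one-parameter group $(T_t)_{t\in\mathbf R}$ of bounded operators on $L^2((\alpha,\beta),\mathbf C^n)$. That is: $T_0=I$, $T_{s+t}=T_sT_t$, $t\mapsto T_tf$ is norm continuous for every $f$, $\mathrm{Dom}(L)$ is exactly the set of $f$ for which $\lim_{t\to0}t^{-1}(T_tf-f)$ exists in norm, and $Lf$ is this limit. -/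

import Mathlib

open MeasureTheory Filter Set
open scoped Topology ContDiff

noncomputable section

/-! ### Strongly continuous one-parameter groups and their generators -/

/-- A strongly continuous one-parameter group of bounded operators on a normed space. -/
structure C0Group (H : Type*) [NormedAddCommGroup H] [NormedSpace ℂ H] where
  /-- The operator at time `t`. -/
  op : ℝ → H →L[ℂ] H
  op_zero : op 0 = ContinuousLinearMap.id ℂ H
  op_add : ∀ s t : ℝ, op (s + t) = (op s).comp (op t)
  continuous_orbit : ∀ f : H, Continuous fun t : ℝ => op t f

namespace C0Group

variable {H : Type*} [NormedAddCommGroup H] [NormedSpace ℂ H]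

/-- The graph of the generator: the pairs `(f, g)` with `g = lim_{t → 0} (T_t f - f) / t`. -/
def generatorGraph (T : C0Group H) : Submodule ℂ (H × H) where
  carrier := {p | Tendsto (fun t : ℝ => (t : ℂ)⁻¹ • (T.op t p.1 - p.1)) (𝓝[≠] 0) (𝓝 p.2)}
  add_mem' := by
    intro p q hp hq
    have h := Tendsto.add hp hq
    refine h.congr fun t => ?_
    simp only [Prod.fst_add, map_add, ← smul_add]
    congr 1
    abel
  zero_mem' := by simp
  smul_mem' := by
    intro c p hp
    have h := Tendsto.const_smul hp c
    refine h.congr fun t => ?_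
    simp only [Prod.smul_fst, map_smul, ← smul_sub]
    rw [smul_comm]

/-- The generator of the group: `f` is in its domain if and only if the limit
`lim_{t → 0} (T_t f - f) / t` exists in norm, and that limit is the value at `f`. -/
def generator (T : C0Group H) : H →ₗ.[ℂ] H := T.generatorGraph.toLinearPMap

theorem mem_graph_generator (T : C0Group H) (f g : H) :
    (f, g) ∈ T.generator.graph ↔
      Tendsto (fun t : ℝ => (t : ℂ)⁻¹ • (T.op t f - f)) (𝓝[≠] 0) (𝓝 g) := by
  have hg : T.generator.graph = T.generatorGraph := by
    apply Submodule.toLinearPMap_graph_eq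
    rintro ⟨x, y⟩ hx h0
    have h0' : x = 0 := h0
    subst h0'
    have hx' : Tendsto (fun t : ℝ => (t : ℂ)⁻¹ • (T.op t (0 : H) - 0)) (𝓝[≠] 0) (𝓝 y) := hx
    simp only [map_zero, sub_zero, smul_zero] at hx'
    exact tendsto_nhds_unique hx' tendsto_const_nhds
  rw [hg]
  rfl

end C0Group

/-! ### The first order system -/

/-- The Hilbert space `L²((α, β), ℂⁿ)`. -/
abbrev L2Interval (α β : ℝ) (n : ℕ) : Type :=
  Lp (EuclideanSpace ℂ (Fin n)) 2 (volume.restrict (Ioo α β))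

/-- `g` is the weak derivative of `f` on `(α, β)`. The Sobolev space `W^{1,2}((α, β), ℂⁿ)`
consists of the `f` for which there is such a `g` in `L²((α, β), ℂⁿ)`. -/
def IsWeakDeriv {α β : ℝ} {n : ℕ} (f g : L2Interval α β n) : Prop :=
  ∀ φ : ℝ → ℝ, ContDiff ℝ ∞ φ → HasCompactSupport φ → tsupport φ ⊆ Ioo α β →
    ∫ x in Ioo α β, deriv φ x • f x = - ∫ x in Ioo α β, φ x • g x

/-- The continuous representative `F` of `f` on `[α, β]` satisfies `F(β) = S F(α)`. -/
def IsQuasiPeriodic {α β : ℝ} {n : ℕ} (S : Matrix (Fin n) (Fin n) ℂ)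
    (f : L2Interval α β n) : Prop :=
  ∃ F : ℝ → EuclideanSpace ℂ (Fin n), ContinuousOn F (Icc α β) ∧
    f =ᵐ[volume.restrict (Ioo α β)] F ∧ F β = Matrix.toEuclideanCLM (𝕜 := ℂ) S (F α)

section helpers

variable {α β : ℝ} {n : ℕ}

theorem integrable_smul_L2 {φ : ℝ → ℝ} (hφ : Continuous φ) (hs : HasCompactSupport φ)
    (f : L2Interval α β n) :
    Integrable (fun x => φ x • f x) (volume.restrict (Ioo α β)) := by
  obtain ⟨C, hC⟩ := hs.exists_bound_of_continuous hφ
  have hf : Integrable f (volume.restrict (Ioo α β)) :=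
    (Lp.memLp f).integrable (by norm_num)
  exact hf.bdd_smul C hφ.aestronglyMeasurable (Eventually.of_forall hC)

theorem IsWeakDeriv.add {f g f' g' : L2Interval α β n} (h : IsWeakDeriv f g)
    (h' : IsWeakDeriv f' g') : IsWeakDeriv (f + f') (g + g') := by
  intro φ h1 h2 h3
  have hd : Continuous (deriv φ) := h1.continuous_deriv (by simp)
  have e1 : ∫ x in Ioo α β, deriv φ x • (f + f' : L2Interval α β n) x
      = ∫ x in Ioo α β, (deriv φ x • f x + deriv φ x • f' x) := by
    apply integral_congr_ae
    filter_upwards [Lp.coeFn_add f f'] with x hx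
    rw [hx, Pi.add_apply, smul_add]
  have e2 : ∫ x in Ioo α β, φ x • (g + g' : L2Interval α β n) x
      = ∫ x in Ioo α β, (φ x • g x + φ x • g' x) := by
    apply integral_congr_ae
    filter_upwards [Lp.coeFn_add g g'] with x hx
    rw [hx, Pi.add_apply, smul_add]
  rw [e1, e2, integral_add (integrable_smul_L2 hd h2.deriv f) (integrable_smul_L2 hd h2.deriv f'),
    integral_add (integrable_smul_L2 h1.continuous h2 g) (integrable_smul_L2 h1.continuous h2 g'),
    h φ h1 h2 h3, h' φ h1 h2 h3]
  abel

theorem IsWeakDeriv.smul {f g : L2Interval α β n} (c : ℂ) (h : IsWeakDeriv f g) :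
    IsWeakDeriv (c • f) (c • g) := by
  intro φ h1 h2 h3
  have key : ∀ (ψ : ℝ → ℝ) (u : L2Interval α β n),
      ∫ x in Ioo α β, ψ x • (c • u : L2Interval α β n) x = c • ∫ x in Ioo α β, ψ x • u x := by
    intro ψ u
    rw [← integral_smul]
    apply integral_congr_ae
    filter_upwards [Lp.coeFn_smul c u] with x hx
    rw [hx, Pi.smul_apply, smul_comm]
  rw [key, key, h φ h1 h2 h3, smul_neg]

theorem IsWeakDeriv.zero : IsWeakDeriv (0 : L2Interval α β n) 0 := by
  have key : ∀ ψ : ℝ → ℝ, ∫ x in Ioo α β, ψ x • (0 : L2Interval α β n) x = 0 := by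
    intro ψ
    apply integral_eq_zero_of_ae
    filter_upwards [Lp.coeFn_zero (EuclideanSpace ℂ (Fin n)) 2 (volume.restrict (Ioo α β))]
      with x hx
    rw [hx]
    simp
  intro φ _ _ _
  rw [key, key, neg_zero]

theorem IsWeakDeriv.eq_zero {g : L2Interval α β n} (h : IsWeakDeriv 0 g) : g = 0 := by
  have hl : LocallyIntegrableOn g (Ioo α β) volume :=
    IntegrableOn.locallyIntegrableOn (show Integrable g (volume.restrict (Ioo α β)) from
      (Lp.memLp g).integrable (by norm_num))
  have h0 : ∀ᵐ x ∂(volume : Measure ℝ), x ∈ Ioo α β → g x = 0 := by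
    refine isOpen_Ioo.ae_eq_zero_of_integral_contDiff_smul_eq_zero hl ?_
    intro φ h1 h2 h3
    have e := h φ h1 h2 h3
    have e0 : ∫ x in Ioo α β, deriv φ x • (0 : L2Interval α β n) x = 0 := by
      apply integral_eq_zero_of_ae
      filter_upwards [Lp.coeFn_zero (EuclideanSpace ℂ (Fin n)) 2 (volume.restrict (Ioo α β))]
        with x hx
      rw [hx]
      simp
    rw [e0, eq_comm, neg_eq_zero] at e
    rw [← e]
    symm
    apply setIntegral_eq_integral_of_forall_compl_eq_zero
    intro x hx
    have : φ x = 0 := image_eq_zero_of_notMem_tsupport fun hx' => hx (h3 hx')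
    rw [this, zero_smul]
  apply Lp.ext
  filter_upwards [(ae_restrict_iff' measurableSet_Ioo).2 h0,
    Lp.coeFn_zero (EuclideanSpace ℂ (Fin n)) 2 (volume.restrict (Ioo α β))] with x hx hx'
  rw [hx, hx']
  rfl

theorem IsQuasiPeriodic.add {S : Matrix (Fin n) (Fin n) ℂ} {f g : L2Interval α β n}
    (hf : IsQuasiPeriodic S f) (hg : IsQuasiPeriodic S g) : IsQuasiPeriodic S (f + g) := by
  obtain ⟨F, hF, hfF, hFb⟩ := hf
  obtain ⟨G, hG, hgG, hGb⟩ := hg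
  refine ⟨F + G, hF.add hG, (Lp.coeFn_add f g).trans (hfF.add hgG), ?_⟩
  rw [Pi.add_apply, Pi.add_apply, map_add, hFb, hGb]

theorem IsQuasiPeriodic.smul {S : Matrix (Fin n) (Fin n) ℂ} {f : L2Interval α β n} (c : ℂ)
    (hf : IsQuasiPeriodic S f) : IsQuasiPeriodic S (c • f) := by
  obtain ⟨F, hF, hfF, hFb⟩ := hf
  refine ⟨c • F, hF.const_smul c, (Lp.coeFn_smul c f).trans (hfF.const_smul c), ?_⟩
  rw [Pi.smul_apply, Pi.smul_apply, map_smul, hFb]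

theorem IsQuasiPeriodic.zero (S : Matrix (Fin n) (Fin n) ℂ) :
    IsQuasiPeriodic S (0 : L2Interval α β n) :=
  ⟨0, continuousOn_const, Lp.coeFn_zero _ _ _, by simp⟩

end helpers

/-- Multiplication by the constant diagonal matrix `A = diag(a₁, …, aₙ)` on `L²((α, β), ℂⁿ)`. -/
def diagMul (α β : ℝ) {n : ℕ} (a : Fin n → ℝ) : L2Interval α β n →L[ℂ] L2Interval α β n :=
  ContinuousLinearMap.compLpL 2 (volume.restrict (Ioo α β))
    (Matrix.toEuclideanCLM (𝕜 := ℂ) (Matrix.diagonal fun i => (a i : ℂ)))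

/-- The graph of the operator `L`: the pairs `(f, A f')` with `f` in `W^{1,2}((α, β), ℂⁿ)` and
`f(β) = S f(α)`. -/
def quasiPeriodicGraph (α β : ℝ) {n : ℕ} (a : Fin n → ℝ) (S : Matrix (Fin n) (Fin n) ℂ) :
    Submodule ℂ (L2Interval α β n × L2Interval α β n) where
  carrier := {p | IsQuasiPeriodic S p.1 ∧ ∃ g, IsWeakDeriv p.1 g ∧ p.2 = diagMul α β a g}
  add_mem' := by
    rintro p q ⟨hp, g, hg, hpg⟩ ⟨hq, k, hk, hqk⟩
    exact ⟨hp.add hq, g + k, hg.add hk, by rw [Prod.snd_add, hpg, hqk, map_add]⟩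
  zero_mem' := ⟨IsQuasiPeriodic.zero S, 0, IsWeakDeriv.zero, by simp⟩
  smul_mem' := by
    rintro c p ⟨hp, g, hg, hpg⟩
    exact ⟨hp.smul c, c • g, hg.smul c, by rw [Prod.smul_snd, hpg, map_smul]⟩

/-- The operator `L f = A f'` in `L²((α, β), ℂⁿ)`, where `A = diag(a₁, …, aₙ)`, with domain
the space of all `f` in `W^{1,2}((α, β), ℂⁿ)` such that `f(β) = S f(α)`. -/
def quasiPeriodicOperator (α β : ℝ) {n : ℕ} (a : Fin n → ℝ) (S : Matrix (Fin n) (Fin n) ℂ) :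
    L2Interval α β n →ₗ.[ℂ] L2Interval α β n :=
  (quasiPeriodicGraph α β a S).toLinearPMap

theorem mem_graph_quasiPeriodicOperator {α β : ℝ} {n : ℕ} (a : Fin n → ℝ)
    (S : Matrix (Fin n) (Fin n) ℂ) (f h : L2Interval α β n) :
    (f, h) ∈ (quasiPeriodicOperator α β a S).graph ↔
      IsQuasiPeriodic S f ∧ ∃ g, IsWeakDeriv f g ∧ h = diagMul α β a g := by
  have hg : (quasiPeriodicOperator α β a S).graph = quasiPeriodicGraph α β a S := by
    apply Submodule.toLinearPMap_graph_eq
    rintro ⟨x, y⟩ ⟨-, g, hg, hy⟩ h0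
    have h0' : x = 0 := h0
    subst h0'
    have hy' : y = diagMul α β a g := hy
    rw [hy', IsWeakDeriv.eq_zero hg, map_zero]
  rw [hg]
  rfl

end

noncomputable section

/-! ### Weak derivatives on an interval -/

/-! The evolution `∂ₜw = A ∂ₓw` decouples inside the interval: the `i`-th component at time `t` is
`w i (x + a i * t)`, so only the boundary couples components. Each initial value is therefore
extended to functions `w i` on the whole line for which `w(β) = S w(α)` holds along characteristics
at every time; `T_t` is then translation of the extension, and the group law is that of
translations.

Such an extension exists because `q = S p` can be solved for the values entering the interval in
terms of those leaving it, and conversely. Forward in time this needs the block of `S` on the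
negative speeds, backward in time the block on the positive ones (`exists_scattering`). Measured in
crossing times the condition is a delay system `v i (s + ℓ i) = ∑ j, M i j * v j s` with `M`
invertible, solved step by step in both directions. For times at most the least crossing time a
single step is enough, so the extension near the interval is a finite sum of affine
reparametrizations of the initial value (`exists_window_formula`). This gives boundedness, and
continuity of translation in `L²(ℝ)` gives strong continuity.

For the generator, both inclusions are proved on the extensions. If `f` is in the domain of `L`,
primitives of the extension of `L f`, divided by the speeds, form an extension of `f`; the
difference quotients of the orbit are averages of an `L²` function and converge to it. If the
difference quotients converge to `h`, applying the group shows that the extension of `h`, divided by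
the speeds, is the weak derivative of the extension of `f` on the whole line, across the end points
too. The extension of `f` then has a continuous representative, and the boundary condition, valid at
almost every time, holds at time zero. -/

theorem integral_deriv_mul_primitive_real {η : ℝ → ℝ} {a b : ℝ}
    (hη : IntervalIntegrable η volume a b) {φ : ℝ → ℝ} (hφ : ContDiff ℝ ∞ φ)
    (h0 : φ a = 0) (h1 : φ b = 0) :
    ∫ x in a..b, deriv φ x * (∫ y in a..x, η y) = - ∫ x in a..b, φ x * η x := by
  have hac : AbsolutelyContinuousOnInterval φ a b :=
    (hφ.contDiffOn.of_le (by simp)).absolutelyContinuousOnInterval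
  have hI := hη.absolutelyContinuousOnInterval_intervalIntegral (c := a) left_mem_uIcc
  have key := AbsolutelyContinuousOnInterval.integral_mul_deriv_eq_deriv_mul hac hI
  rw [h0, h1] at key
  have e : ∫ x in a..b, φ x * deriv (fun x => ∫ y in a..x, η y) x = ∫ x in a..b, φ x * η x := by
    apply intervalIntegral.integral_congr_ae
    filter_upwards [hη.ae_hasDerivAt_integral] with x hx hx'
    rw [(hx (uIoc_subset_uIcc hx') a left_mem_uIcc).deriv]
  rw [e] at key
  linarith

/-- Real and imaginary parts are real linear and commute with the integrals, which reduces the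
identity to real integration by parts. -/
theorem integral_deriv_smul_primitive {η : ℝ → ℂ} {a b : ℝ}
    (hη : IntervalIntegrable η volume a b) {φ : ℝ → ℝ} (hφ : ContDiff ℝ ∞ φ)
    (h0 : φ a = 0) (h1 : φ b = 0) :
    ∫ x in a..b, deriv φ x • (∫ y in a..x, η y) = - ∫ x in a..b, φ x • η x := by
  have hd : Continuous (deriv φ) := hφ.continuous_deriv (by simp)
  have i1 : IntervalIntegrable (fun x => deriv φ x • (∫ y in a..x, η y)) volume a b :=
    (hd.continuousOn.smul
      (intervalIntegral.continuousOn_primitive_interval' hη left_mem_uIcc)).intervalIntegrable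
  have i2 : IntervalIntegrable (fun x => φ x • η x) volume a b :=
    hη.continuousOn_smul hφ.continuous.continuousOn
  have key : ∀ ℓ : ℂ →L[ℝ] ℝ, ℓ (∫ x in a..b, deriv φ x • (∫ y in a..x, η y))
      = ℓ (- ∫ x in a..b, φ x • η x) := by
    intro ℓ
    have hℓ : IntervalIntegrable (fun x => ℓ (η x)) volume a b :=
      ⟨ℓ.integrable_comp hη.1, ℓ.integrable_comp hη.2⟩
    have e := integral_deriv_mul_primitive_real hℓ hφ h0 h1
    rw [map_neg, ← ℓ.intervalIntegral_comp_comm i1, ← ℓ.intervalIntegral_comp_comm i2]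
    simp only [map_smul, smul_eq_mul]
    rw [← e]
    apply intervalIntegral.integral_congr
    intro x hx
    have hx' : IntervalIntegrable η volume a x := hη.mono_set (uIcc_subset_uIcc_left hx)
    simp only [ℓ.intervalIntegral_comp_comm hx']
  exact Complex.ext (key Complex.reCLM) (key Complex.imCLM)

/-- A compactly supported smooth function of integral zero has a compactly supported smooth
antiderivative. -/
theorem exists_antideriv_of_integral_eq_zero {a b : ℝ} {ψ : ℝ → ℝ} (hψ : ContDiff ℝ ∞ ψ)
    (hs : tsupport ψ ⊆ Ioo a b) (hc : HasCompactSupport ψ) (h0 : ∫ x, ψ x = 0) :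
    ∃ φ : ℝ → ℝ, ContDiff ℝ ∞ φ ∧ HasCompactSupport φ ∧ tsupport φ ⊆ Ioo a b ∧ deriv φ = ψ := by
  rcases (tsupport ψ).eq_empty_or_nonempty with he | hne
  · refine ⟨0, contDiff_const, HasCompactSupport.zero, by simp [tsupport], ?_⟩
    rw [tsupport_eq_empty_iff] at he
    ext x; simp [he]
  have hK : IsCompact (tsupport ψ) := hc
  obtain ⟨p, hp, hpm⟩ := hK.exists_isLeast hne
  obtain ⟨q, hq, hqm⟩ := hK.exists_isGreatest hne
  have hd : ∀ x, HasDerivAt (fun x => ∫ y in a..x, ψ y) (ψ x) x := fun x =>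
    intervalIntegral.integral_hasDerivAt_right (hψ.continuous.intervalIntegrable _ _)
      (hψ.continuous.stronglyMeasurableAtFilter _ _) hψ.continuous.continuousAt
  have hde : deriv (fun x => ∫ y in a..x, ψ y) = ψ := funext fun x => (hd x).deriv
  have hz : ∀ x, x ∉ Icc p q → ψ x = 0 := fun x hx =>
    image_eq_zero_of_notMem_tsupport fun hx' => hx ⟨hpm hx', hqm hx'⟩
  -- Left of `p` the integrand vanishes; right of `q` the primitive equals the full integral of `ψ`,
  -- which is zero.
  have hsub : tsupport (fun x => ∫ y in a..x, ψ y) ⊆ Icc p q := by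
    apply closure_minimal _ isClosed_Icc
    intro x hx
    by_contra hn
    apply hx
    rcases not_and_or.1 hn with h | h
    · push Not at h
      have : ∀ y ∈ uIcc a x, ψ y = 0 := by
        intro y hy
        apply hz
        intro hy'
        have := hy'.1.trans hy.2
        rcases le_total a x with h' | h'
        · rw [max_eq_right h'] at this; linarith
        · rw [max_eq_left h'] at this; linarith [(hs hp).1]
      simpa using intervalIntegral.integral_congr (g := fun _ => (0:ℝ)) (μ := volume) this
    · push Not at h
      have hsup : Function.support ψ ⊆ Ioc a x := by
        intro y hy
        have := subset_tsupport _ hy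
        exact ⟨(hs this).1, (hqm this).trans h.le⟩
      change ∫ y in a..x, ψ y = 0
      rw [intervalIntegral.integral_eq_integral_of_support_subset hsup, h0]
  refine ⟨fun x => ∫ y in a..x, ψ y, ?_, ?_, ?_, hde⟩
  · rw [contDiff_infty_iff_deriv, hde]
    exact ⟨fun x => (hd x).differentiableAt, hψ⟩
  · exact isCompact_Icc.of_isClosed_subset (isClosed_tsupport _) hsub
  · exact hsub.trans fun x hx => ⟨(hs hp).1.trans_le hx.1, hx.2.trans_lt (hs hq).2⟩

theorem integrableOn_smul_of_compactSupport {u : ℝ → ℂ} {s : Set ℝ} (hu : IntegrableOn u s)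
    {φ : ℝ → ℝ} (hφ : Continuous φ) (hc : HasCompactSupport φ) :
    IntegrableOn (fun x => φ x • u x) s := by
  obtain ⟨C, hC⟩ := hc.exists_bound_of_continuous hφ
  exact Integrable.bdd_smul hu C hφ.aestronglyMeasurable (Eventually.of_forall hC)

/-- The lemma of du Bois-Reymond on a bounded interval. -/
theorem ae_eq_const_of_integral_deriv_smul_eq_zero {a b : ℝ} (hab : a < b) {u : ℝ → ℂ}
    (hu : IntegrableOn u (Ioo a b))
    (h : ∀ φ : ℝ → ℝ, ContDiff ℝ ∞ φ → HasCompactSupport φ → tsupport φ ⊆ Ioo a b →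
      ∫ x in Ioo a b, deriv φ x • u x = 0) :
    ∃ c : ℂ, ∀ᵐ x ∂volume.restrict (Ioo a b), u x = c := by
  -- A bump of integral one in the middle of the interval; the constant will be the mean of `u`
  -- against it.
  let B : ContDiffBump ((a + b) / 2) := ⟨(b - a) / 8, (b - a) / 4, by linarith, by linarith⟩
  set ψ₀ : ℝ → ℝ := B.normed volume with hψ₀
  have hs₀ : tsupport ψ₀ ⊆ Ioo a b := by
    rw [hψ₀, B.tsupport_normed_eq, Real.closedBall_eq_Icc]
    intro x hx
    have h1 : B.rOut = (b - a) / 4 := rfl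
    rw [h1] at hx
    constructor <;> linarith [hx.1, hx.2]
  have hc₀ : HasCompactSupport ψ₀ := B.hasCompactSupport_normed
  have hd₀ : ContDiff ℝ ∞ ψ₀ := B.contDiff_normed
  have hi₀ : ∫ x, ψ₀ x = 1 := B.integral_normed
  set c : ℂ := ∫ x in Ioo a b, ψ₀ x • u x with hcdef
  have hfull : ∀ ψ : ℝ → ℝ, tsupport ψ ⊆ Ioo a b → ∫ x in Ioo a b, ψ x = ∫ x, ψ x := by
    intro ψ hψ
    apply setIntegral_eq_integral_of_forall_compl_eq_zero
    intro x hx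
    exact image_eq_zero_of_notMem_tsupport fun hx' => hx (hψ hx')
  -- Subtracting from `ψ` its integral times `ψ₀` leaves a function of integral zero, hence the
  -- derivative of a test function.
  have key : ∀ ψ : ℝ → ℝ, ContDiff ℝ ∞ ψ → HasCompactSupport ψ → tsupport ψ ⊆ Ioo a b →
      ∫ x in Ioo a b, ψ x • (u x - c) = 0 := by
    intro ψ h1 h2 h3
    have hψi : Integrable ψ := h1.continuous.integrable_of_hasCompactSupport h2
    have hψ₀i : Integrable ψ₀ := hd₀.continuous.integrable_of_hasCompactSupport hc₀
    set m := ∫ x, ψ x with hm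
    have hsup : tsupport (fun x => ψ x - m * ψ₀ x) ⊆ Ioo a b := by
      refine (tsupport_sub ψ (fun x => m * ψ₀ x)).trans (union_subset h3 ?_)
      exact (tsupport_mul_subset_right (f := fun _ => m) (g := ψ₀)).trans hs₀
    obtain ⟨φ, p1, p2, p3, p4⟩ := exists_antideriv_of_integral_eq_zero
      (ψ := fun x => ψ x - m * ψ₀ x) (h1.sub (contDiff_const.mul hd₀)) hsup
      (h2.sub (hc₀.mul_left (f := fun _ => m)))
      (by rw [integral_sub hψi (hψ₀i.const_mul m), integral_const_mul, hi₀, mul_one, sub_self])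
    have e := h φ p1 p2 p3
    rw [p4] at e
    have i1 := integrableOn_smul_of_compactSupport hu h1.continuous h2
    have i2 := integrableOn_smul_of_compactSupport hu hd₀.continuous hc₀
    have e2 : ∫ x in Ioo a b, (ψ x - m * ψ₀ x) • u x
        = (∫ x in Ioo a b, ψ x • u x) - m • c := by
      simp_rw [sub_smul, mul_smul]
      rw [integral_sub (g := fun x => m • ψ₀ x • u x) i1 (Integrable.smul m i2), integral_smul]
    rw [e2] at e
    simp_rw [smul_sub]
    rw [integral_sub i1 (hψi.integrableOn.smul_const c), integral_smul_const, hfull ψ h3, e]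
  refine ⟨c, ?_⟩
  have hl : LocallyIntegrableOn (fun x => u x - c) (Ioo a b) volume :=
    (hu.sub (integrableOn_const (by simp))).locallyIntegrableOn
  have h0 : ∀ᵐ x ∂(volume : Measure ℝ), x ∈ Ioo a b → u x - c = 0 := by
    refine isOpen_Ioo.ae_eq_zero_of_integral_contDiff_smul_eq_zero hl ?_
    intro φ h1 h2 h3
    rw [← key φ h1 h2 h3]
    symm
    apply setIntegral_eq_integral_of_forall_compl_eq_zero
    intro x hx
    rw [image_eq_zero_of_notMem_tsupport fun hx' => hx (h3 hx'), zero_smul]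
  filter_upwards [(ae_restrict_iff' measurableSet_Ioo).2 h0] with x hx
  exact sub_eq_zero.1 hx

/-- A function with an integrable weak derivative on a bounded interval agrees almost everywhere
with a primitive of that derivative. -/
theorem ae_eq_const_add_primitive {a b : ℝ} (hab : a < b) {u η : ℝ → ℂ}
    (hu : IntegrableOn u (Ioo a b)) (hη : IntegrableOn η (Ioo a b))
    (h : ∀ φ : ℝ → ℝ, ContDiff ℝ ∞ φ → HasCompactSupport φ → tsupport φ ⊆ Ioo a b →
      ∫ x in Ioo a b, deriv φ x • u x = - ∫ x in Ioo a b, φ x • η x) :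
    ∃ c : ℂ, ∀ᵐ x ∂volume.restrict (Ioo a b), u x = c + ∫ y in a..x, η y := by
  have hηi : IntervalIntegrable η volume a b := by
    rw [intervalIntegrable_iff_integrableOn_Ioc_of_le hab.le]
    exact hη.congr_set_ae Ioo_ae_eq_Ioc.symm
  have hcont : ContinuousOn (fun x => ∫ y in a..x, η y) (Icc a b) :=
    intervalIntegral.continuousOn_primitive_interval
      (by rw [uIcc_of_le hab.le]; exact hη.congr_set_ae Ioo_ae_eq_Icc.symm)
      |>.mono (by rw [uIcc_of_le hab.le])
  have hpi : IntegrableOn (fun x => ∫ y in a..x, η y) (Ioo a b) :=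
    (hcont.integrableOn_Icc).mono_set Ioo_subset_Icc_self
  -- The difference of `u` and the primitive of `η` has weak derivative zero.
  obtain ⟨c, hc⟩ := ae_eq_const_of_integral_deriv_smul_eq_zero hab
    (u := fun x => u x - ∫ y in a..x, η y) (hu.sub hpi) (by
      intro φ h1 h2 h3
      have e := integral_deriv_smul_primitive hηi h1
        (image_eq_zero_of_notMem_tsupport fun hx => lt_irrefl _ (h3 hx).1)
        (image_eq_zero_of_notMem_tsupport fun hx => lt_irrefl _ (h3 hx).2)
      rw [intervalIntegral.integral_of_le hab.le, intervalIntegral.integral_of_le hab.le,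
        integral_Ioc_eq_integral_Ioo, integral_Ioc_eq_integral_Ioo] at e
      have hd : Continuous (deriv φ) := h1.continuous_deriv (by simp)
      simp_rw [smul_sub]
      rw [integral_sub (integrableOn_smul_of_compactSupport hu hd h2.deriv)
        (integrableOn_smul_of_compactSupport hpi hd h2.deriv), h φ h1 h2 h3, e, sub_self])
  exact ⟨c, hc.mono fun x hx => by rw [← hx]; ring⟩

/-! ### Difference quotients -/

theorem tendsto_eLpNorm_translate_sub {w : ℝ → ℂ} (hw : MemLp w 2) :
    Tendsto (fun s : ℝ => eLpNorm (fun x => w (x + s) - w x) 2) (𝓝 0) (𝓝 0) := by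
  have : Fact ((2 : ENNReal) ≠ ⊤) := ⟨by simp⟩
  have hc : Continuous fun s : ℝ => (DomAddAct.mk s +ᵥ hw.toLp w : Lp ℂ 2 volume) :=
    DomAddAct.continuous_mk.vadd continuous_const
  have hc' : Continuous fun s : ℝ => ‖(DomAddAct.mk s +ᵥ hw.toLp w : Lp ℂ 2 volume) - hw.toLp w‖ₑ :=
    (hc.sub continuous_const).enorm
  have h0 := hc'.tendsto 0
  have e0 : (DomAddAct.mk (0 : ℝ) +ᵥ hw.toLp w : Lp ℂ 2 volume) = hw.toLp w := by
    rw [DomAddAct.mk_zero, zero_vadd]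
  rw [e0, sub_self, enorm_zero] at h0
  refine h0.congr fun s => ?_
  rw [DomAddAct.mk_vadd_toLp, ← MemLp.toLp_sub, Lp.enorm_toLp]
  congr 1
  ext x
  simp [add_comm]

/-- Cauchy–Schwarz on an interval of length `|τ|`: passing from `L²` to `L¹` costs `|τ|^(1/2)`,
whose square cancels one of the two factors `|τ|⁻¹`. -/
theorem enorm_average_sq_le {g : ℝ → ℂ} {τ : ℝ} (hτ : τ ≠ 0)
    (hg : AEStronglyMeasurable g (volume.restrict (uIoc 0 τ))) :
    ‖τ⁻¹ • ∫ y in (0:ℝ)..τ, g y‖ₑ ^ (2 : ℝ)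
      ≤ ENNReal.ofReal |τ|⁻¹ * ∫⁻ y in uIoc 0 τ, ‖g y‖ₑ ^ (2 : ℝ) := by
  have hvol : volume.restrict (uIoc 0 τ) univ = ENNReal.ofReal |τ| := by
    simp
  have h1 : ‖∫ y in (0:ℝ)..τ, g y‖ₑ ≤ eLpNorm g 1 (volume.restrict (uIoc 0 τ)) := by
    rw [eLpNorm_one_eq_lintegral_enorm]
    refine le_trans (le_of_eq ?_) (enorm_integral_le_lintegral_enorm _)
    rw [← ofReal_norm, ← ofReal_norm, intervalIntegral.norm_intervalIntegral_eq]
  have h2 := eLpNorm_le_eLpNorm_mul_rpow_measure_univ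
    (show (1 : ENNReal) ≤ 2 by norm_num) hg
  have h3 : eLpNorm g 2 (volume.restrict (uIoc 0 τ)) ^ (2 : ℝ)
      = ∫⁻ y in uIoc 0 τ, ‖g y‖ₑ ^ (2 : ℝ) := by
    have := eLpNorm_nnreal_pow_eq_lintegral (f := g) (μ := volume.restrict (uIoc 0 τ))
      (p := 2) (by norm_num)
    simpa using this
  have hc : ENNReal.ofReal |τ|⁻¹ * ENNReal.ofReal |τ| = 1 := by
    rw [← ENNReal.ofReal_mul (by positivity), inv_mul_cancel₀ (abs_ne_zero.2 hτ),
      ENNReal.ofReal_one]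
  have hn : ‖τ⁻¹ • ∫ y in (0:ℝ)..τ, g y‖ₑ = ENNReal.ofReal |τ|⁻¹ * ‖∫ y in (0:ℝ)..τ, g y‖ₑ := by
    rw [enorm_smul, ← ofReal_norm, Real.norm_eq_abs, abs_inv]
  have h4 : (ENNReal.ofReal |τ| ^ (1 / (1 : ENNReal).toReal - 1 / (2 : ENNReal).toReal)) ^ (2 : ℝ)
      = ENNReal.ofReal |τ| := by
    rw [← ENNReal.rpow_mul]
    norm_num
  calc ‖τ⁻¹ • ∫ y in (0:ℝ)..τ, g y‖ₑ ^ (2 : ℝ)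
      ≤ (ENNReal.ofReal |τ|⁻¹ * (eLpNorm g 2 (volume.restrict (uIoc 0 τ)) * ENNReal.ofReal |τ| ^
        (1 / (1 : ENNReal).toReal - 1 / (2 : ENNReal).toReal))) ^ (2 : ℝ) := by
        rw [hn]
        gcongr
        rw [hvol] at h2
        exact h1.trans h2
    _ = ENNReal.ofReal |τ|⁻¹ * (ENNReal.ofReal |τ|⁻¹ * ENNReal.ofReal |τ|)
        * ∫⁻ y in uIoc 0 τ, ‖g y‖ₑ ^ (2 : ℝ) := by
        rw [ENNReal.mul_rpow_of_nonneg _ _ (by norm_num),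
          ENNReal.mul_rpow_of_nonneg _ _ (by norm_num), h4, h3, ENNReal.rpow_two]
        ring
    _ = _ := by rw [hc, mul_one]

/-- The error is the average over `y` of `w (x + y) - w x`. Cauchy–Schwarz for fixed `x` and Tonelli
bound its squared norm by the average of the squared translation errors. Strong measurability of `w`
supplies the joint measurability for Tonelli. -/
theorem eLpNorm_average_sub_le {w : ℝ → ℂ} (hw : MemLp w 2) (hm : StronglyMeasurable w)
    {τ : ℝ} (hτ : τ ≠ 0) {ε : ENNReal}
    (hε : ∀ s, |s| ≤ |τ| → eLpNorm (fun x => w (x + s) - w x) 2 ≤ ε) :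
    eLpNorm (fun x => τ⁻¹ • (∫ y in (0:ℝ)..τ, w (x + y)) - w x) 2 ≤ ε := by
  have hsq : ∀ g : ℝ → ℂ, eLpNorm g 2 ^ (2 : ℝ) = ∫⁻ x, ‖g x‖ₑ ^ (2 : ℝ) := by
    intro g
    have := eLpNorm_nnreal_pow_eq_lintegral (f := g) (μ := volume) (p := 2) (by norm_num)
    simpa using this
  rw [← ENNReal.rpow_le_rpow_iff (z := 2) (by norm_num), hsq]
  have hmeas : Measurable fun p : ℝ × ℝ => ‖w (p.1 + p.2) - w p.1‖ₑ ^ (2 : ℝ) := by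
    have := hm.measurable
    fun_prop
  have hloc : LocallyIntegrable w := hw.locallyIntegrable (by norm_num)
  have hpt : ∀ x, τ⁻¹ • (∫ y in (0:ℝ)..τ, w (x + y)) - w x
      = τ⁻¹ • ∫ y in (0:ℝ)..τ, (w (x + y) - w x) := by
    intro x
    have hi : IntervalIntegrable (fun y => w (x + y)) volume 0 τ := by
      have : IntervalIntegrable w volume (x + 0) (x + τ) :=
        (hloc.integrableOn_isCompact isCompact_uIcc).intervalIntegrable
      simpa using this.comp_add_left x
    rw [intervalIntegral.integral_sub hi (by simp), smul_sub]
    simp [hτ]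
  calc ∫⁻ x, ‖τ⁻¹ • (∫ y in (0:ℝ)..τ, w (x + y)) - w x‖ₑ ^ (2 : ℝ)
      ≤ ∫⁻ x, ENNReal.ofReal |τ|⁻¹ * ∫⁻ y in uIoc 0 τ, ‖w (x + y) - w x‖ₑ ^ (2 : ℝ) := by
        apply lintegral_mono
        intro x
        dsimp only
        rw [hpt]
        apply enorm_average_sq_le hτ
        have := hm.comp_measurable (measurable_const_add x)
        exact (this.sub stronglyMeasurable_const).aestronglyMeasurable
    _ = ENNReal.ofReal |τ|⁻¹ * ∫⁻ y in uIoc 0 τ, ∫⁻ x, ‖w (x + y) - w x‖ₑ ^ (2 : ℝ) := by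
        rw [lintegral_const_mul _ hmeas.lintegral_prod_right', lintegral_lintegral_swap]
        exact hmeas.aemeasurable
    _ ≤ ENNReal.ofReal |τ|⁻¹ * ∫⁻ _ in uIoc 0 τ, ε ^ (2 : ℝ) := by
        refine mul_le_mul_right (setLIntegral_mono measurable_const ?_) _
        intro y hy
        rw [← hsq]
        gcongr
        apply hε
        simp only [uIoc, mem_Ioc] at hy
        rcases le_total 0 τ with h | h
        · rw [min_eq_left h, max_eq_right h] at hy
          rw [abs_of_pos hy.1, abs_of_nonneg h]
          exact hy.2
        · rw [min_eq_right h, max_eq_left h] at hy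
          rw [abs_of_nonpos hy.2, abs_of_nonpos h]
          linarith [hy.1]
    _ = ε ^ (2 : ℝ) := by
        rw [setLIntegral_const]
        have hc : ENNReal.ofReal |τ|⁻¹ * volume (uIoc 0 τ) = 1 := by
          rw [Real.volume_uIoc, sub_zero, ← ENNReal.ofReal_mul (by positivity),
            inv_mul_cancel₀ (abs_ne_zero.2 hτ), ENNReal.ofReal_one]
        rw [mul_left_comm, hc, mul_one]

/-- Difference quotients of a primitive of an `L²` function converge to it in `L²`. -/
theorem tendsto_eLpNorm_average_sub {w : ℝ → ℂ} (hw : MemLp w 2) :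
    Tendsto (fun τ : ℝ => eLpNorm (fun x => τ⁻¹ • (∫ y in (0:ℝ)..τ, w (x + y)) - w x) 2)
      (𝓝[≠] 0) (𝓝 0) := by
  set w' := hw.1.mk w with hw'
  have hae : w =ᵐ[volume] w' := hw.1.ae_eq_mk
  have hm : StronglyMeasurable w' := hw.1.stronglyMeasurable_mk
  have hwl : MemLp w' 2 := hw.ae_eq hae
  have hE : ∀ τ : ℝ, eLpNorm (fun x => τ⁻¹ • (∫ y in (0:ℝ)..τ, w (x + y)) - w x) 2
      = eLpNorm (fun x => τ⁻¹ • (∫ y in (0:ℝ)..τ, w' (x + y)) - w' x) 2 := by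
    intro τ
    apply eLpNorm_congr_ae
    filter_upwards [hae] with x hx
    rw [hx]
    congr 2
    apply intervalIntegral.integral_congr_ae
    have : ∀ᵐ y, w (x + y) = w' (x + y) :=
      (measurePreserving_add_left volume x).quasiMeasurePreserving.ae hae
    filter_upwards [this] with y hy _ using hy
  simp_rw [hE]
  rw [ENNReal.tendsto_nhds_zero]
  intro ε hε
  have h1 := ENNReal.tendsto_nhds_zero.1 (tendsto_eLpNorm_translate_sub hwl) ε hε
  obtain ⟨d, hd, hball⟩ := Metric.eventually_nhds_iff.1 h1
  rw [eventually_nhdsWithin_iff, Metric.eventually_nhds_iff]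
  refine ⟨d, hd, fun τ hτ hτ0 => eLpNorm_average_sub_le hwl hm hτ0 fun s hs => hball ?_⟩
  rw [dist_zero_right, Real.norm_eq_abs] at hτ ⊢
  exact hs.trans_lt hτ

/-- If the difference quotients of `u` converge to `η` locally in `L¹`, then `η` is the weak
derivative of `u`. -/
theorem integral_deriv_smul_of_tendsto_quotient {u η : ℝ → ℂ} (hu : LocallyIntegrable u)
    (hη : LocallyIntegrable η)
    (h : ∀ K : Set ℝ, IsCompact K → Tendsto
      (fun τ : ℝ => ∫⁻ x in K, ‖τ⁻¹ • (u (x + τ) - u x) - η x‖ₑ) (𝓝[≠] 0) (𝓝 0))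
    {φ : ℝ → ℝ} (hφ : ContDiff ℝ ∞ φ) (hc : HasCompactSupport φ) :
    ∫ x, deriv φ x • u x = - ∫ x, φ x • η x := by
  have hu' : ∀ τ : ℝ, LocallyIntegrable fun x => u (x + τ) := by
    intro τ x
    obtain ⟨s, hs, hi⟩ := hu (x + τ)
    refine ⟨(fun x => x + τ) ⁻¹' s, (continuous_add_const τ).continuousAt hs, ?_⟩
    exact ((measurePreserving_add_right volume τ).integrableOn_comp_preimage
      (MeasurableEquiv.addRight τ).measurableEmbedding).2 hi
  have hint : ∀ v : ℝ → ℂ, LocallyIntegrable v → Integrable (fun x => φ x • v x) := fun v hv =>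
    hv.integrable_smul_left_of_hasCompactSupport hφ.continuous hc
  obtain ⟨C, hC⟩ := hc.exists_bound_of_continuous hφ.continuous
  set q : ℝ → ℝ → ℂ := fun τ x => τ⁻¹ • (u (x + τ) - u x) with hq
  have hql : ∀ τ, LocallyIntegrable (q τ) := fun τ => ((hu' τ).sub hu).smul τ⁻¹
  -- First evaluation of the limit: `φ` is bounded with compact support, so local `L¹` convergence
  -- passes to the integral.
  have lim1 : Tendsto (fun τ => ∫ x, φ x • q τ x) (𝓝[≠] 0) (𝓝 (∫ x, φ x • η x)) := by
    rw [tendsto_iff_edist_tendsto_0]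
    have hK := h (tsupport φ) hc
    have hK' : Tendsto (fun τ : ℝ => ENNReal.ofReal C * ∫⁻ x in tsupport φ, ‖q τ x - η x‖ₑ)
        (𝓝[≠] 0) (𝓝 0) := by
      have := ENNReal.Tendsto.const_mul hK (Or.inr (ENNReal.ofReal_ne_top (r := C)))
      rwa [mul_zero] at this
    refine tendsto_of_tendsto_of_tendsto_of_le_of_le tendsto_const_nhds hK'
      (fun _ => zero_le) fun τ => ?_
    dsimp only
    rw [edist_eq_enorm_sub, ← integral_sub (hint _ (hql τ)) (hint _ hη)]
    refine (enorm_integral_le_lintegral_enorm _).trans ?_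
    rw [← lintegral_const_mul' _ _ ENNReal.ofReal_ne_top,
      ← lintegral_indicator (isClosed_tsupport φ).measurableSet]
    apply lintegral_mono
    intro x
    dsimp only
    rw [← smul_sub]
    by_cases hx : x ∈ tsupport φ
    · rw [indicator_of_mem hx, enorm_smul]
      gcongr
      rw [← ofReal_norm]
      exact ENNReal.ofReal_le_ofReal (hC x)
    · rw [image_eq_zero_of_notMem_tsupport hx, zero_smul, enorm_zero]
      exact zero_le
  -- Second evaluation: translation invariance moves the difference quotient onto `φ`, where
  -- dominated convergence applies.
  have lim2 : Tendsto (fun τ => ∫ x, φ x • q τ x) (𝓝[≠] 0) (𝓝 (- ∫ x, deriv φ x • u x)) := by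
    have e : ∀ τ, ∫ x, φ x • q τ x = ∫ x, (τ⁻¹ * (φ (x - τ) - φ x)) • u x := by
      intro τ
      have i1 : Integrable fun x => φ (x - τ) • u x := by
        have := (hint _ (hu' τ)).comp_sub_right τ
        simpa using this
      have e1 : ∫ x, φ (x - τ) • u x = ∫ x, φ x • u (x + τ) := by
        rw [← integral_add_right_eq_self _ τ]
        simp
      have e2 : (fun x => φ x • q τ x) = fun x => τ⁻¹ • (φ x • u (x + τ) - φ x • u x) := by
        ext x
        simp only [hq]
        rw [smul_comm, smul_sub]
      have e3 : (fun x => (τ⁻¹ * (φ (x - τ) - φ x)) • u x)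
          = fun x => τ⁻¹ • (φ (x - τ) • u x - φ x • u x) := by
        ext x
        rw [mul_smul, sub_smul]
      rw [e2, e3, integral_smul, integral_smul, integral_sub (hint _ (hu' τ)) (hint _ hu),
        integral_sub i1 (hint _ hu), e1]
    simp_rw [e]
    rw [← integral_neg]
    obtain ⟨D, hD⟩ := hc.deriv.exists_bound_of_continuous (hφ.continuous_deriv (by simp))
    have hdiff : ∀ x, HasDerivAt φ (deriv φ x) x := fun x =>
      (hφ.differentiable (by simp) x).hasDerivAt
    have hlip : ∀ x y, ‖φ y - φ x‖ ≤ D * ‖y - x‖ := fun x y =>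
      convex_univ.norm_image_sub_le_of_norm_hasDerivWithin_le
        (fun z _ => (hdiff z).hasDerivWithinAt) (fun z _ => hD z) (mem_univ x) (mem_univ y)
    -- For `|τ| < 1` all difference quotients of `φ` are supported in this compact set and bounded
    -- there by the Lipschitz constant `D`.
    set K := Metric.cthickening 1 (tsupport φ) with hKdef
    have hK : IsCompact K := IsCompact.cthickening hc
    apply tendsto_integral_filter_of_dominated_convergence (K.indicator fun x => D * ‖u x‖)
    · refine Eventually.of_forall fun τ =>
        AEStronglyMeasurable.fun_smul ?_ hu.aestronglyMeasurable
      have := hφ.continuous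
      exact (by fun_prop : Continuous fun x => τ⁻¹ * (φ (x - τ) - φ x)).aestronglyMeasurable
    · have hnear : ∀ᶠ τ : ℝ in 𝓝[≠] 0, |τ| < 1 := by
        apply eventually_nhdsWithin_of_eventually_nhds
        have := Metric.ball_mem_nhds (0 : ℝ) one_pos
        filter_upwards [this] with τ hτ
        simpa using hτ
      filter_upwards [hnear, self_mem_nhdsWithin] with τ hτ hτ0
      refine Eventually.of_forall fun x => ?_
      have hτ0' : τ ≠ 0 := hτ0
      by_cases hx : x ∈ K
      · rw [indicator_of_mem hx, norm_smul, norm_mul, norm_inv]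
        gcongr
        have h1 := hlip x (x - τ)
        rw [sub_sub_cancel_left, norm_neg] at h1
        rw [inv_mul_le_iff₀ (norm_pos_iff.2 hτ0')]
        linarith
      · have h1 : ∀ y, |x - y| ≤ 1 → φ y = 0 := by
          intro y hy
          apply image_eq_zero_of_notMem_tsupport
          intro hy'
          exact hx (Metric.mem_cthickening_of_dist_le x y 1 _ hy' hy)
        rw [indicator_of_notMem hx, h1 x (by simp), h1 (x - τ) (by simpa using hτ.le)]
        simp
    · rw [integrable_indicator_iff hK.measurableSet]
      exact ((hu.integrableOn_isCompact hK).norm).const_mul D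
    · refine Eventually.of_forall fun x => ?_
      rw [← neg_smul]
      apply Tendsto.smul_const
      have h1 : HasDerivAt (fun τ : ℝ => φ (x - τ)) (- deriv φ x) 0 := by
        have h2 : HasDerivAt (fun τ : ℝ => x - τ) (-1) 0 := by
          simpa using (hasDerivAt_id (0 : ℝ)).const_sub x
        have h3 : HasDerivAt φ (deriv φ x) (x - 0) := by simpa using hdiff x
        simpa [Function.comp_def] using h3.comp (0 : ℝ) h2
      have := h1.tendsto_slope_zero
      simpa using this
  rw [tendsto_nhds_unique lim1 lim2, neg_neg]

/-! ### Delay systems -/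

section Delay

variable {ι : Type*} [Fintype ι]

/-- The solution of `v i (s + ℓ i) = ∑ j, M i j * v j s` with initial data `h i` on `[0, ℓ i)`,
where `N` is the inverse of `M`. -/
def delaySolution {δ : ℝ} (hδ : 0 < δ) {ℓ : ι → ℝ} (hℓ : ∀ i, δ ≤ ℓ i) (M N : Matrix ι ι ℂ)
    (h : ι → ℝ → ℂ) (i : ι) (t : ℝ) : ℂ :=
  if _ : t < 0 then
    -- If `t + ℓ k ≥ 0`, this time already lies in `[0, ℓ k)` and the data are read off directly; a
    -- recursive call there need not bring the time closer to zero.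
    ∑ k, N i k * (if _ : t + ℓ k < 0 then delaySolution hδ hℓ M N h k (t + ℓ k)
      else h k (t + ℓ k))
  else if _ : t < ℓ i then h i t
  else ∑ k, M i k * delaySolution hδ hℓ M N h k (t - ℓ i)
-- Every recursive call moves `t` towards zero by at least `δ` without crossing it.
termination_by ⌊|t| / δ⌋₊
decreasing_by
  all_goals
    have key : ∀ x y : ℝ, 0 ≤ y → y + δ ≤ x → ⌊y / δ⌋₊ < ⌊x / δ⌋₊ := by
      intro x y hy hxy
      have hx : 0 ≤ x := by linarith
      rw [← Nat.add_one_le_iff, Nat.le_floor_iff (by positivity)]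
      push_cast
      have h1 := Nat.floor_le (by positivity : 0 ≤ y / δ)
      have h2 : y / δ + 1 = (y + δ) / δ := by field_simp
      calc (⌊y / δ⌋₊ : ℝ) + 1 ≤ y / δ + 1 := by linarith
        _ = (y + δ) / δ := h2
        _ ≤ x / δ := by gcongr
  · apply key _ _ (abs_nonneg _)
    rw [abs_of_neg ‹t + ℓ k < 0›, abs_of_neg ‹t < 0›]
    linarith [hℓ k]
  · apply key _ _ (abs_nonneg _)
    have := hℓ i
    rw [abs_of_nonneg (by linarith), abs_of_nonneg (by linarith)]
    linarith

variable {δ : ℝ} {ℓ : ι → ℝ} {M N : Matrix ι ι ℂ}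

theorem delaySolution_of_mem (hδ : 0 < δ) (hℓ : ∀ i, δ ≤ ℓ i) (h : ι → ℝ → ℂ) {i : ι} {t : ℝ}
    (h0 : 0 ≤ t) (h1 : t < ℓ i) : delaySolution hδ hℓ M N h i t = h i t := by
  rw [delaySolution, dif_neg (not_lt.2 h0), dif_pos h1]

/-- For `s ≥ 0` this is the forward recursion. For `s < 0` the values at `s` were defined by
applying `N` to the values at `s + ℓ k`, and `M` undoes this. -/
theorem delaySolution_add [DecidableEq ι] (hδ : 0 < δ) (hℓ : ∀ i, δ ≤ ℓ i) (hMN : M * N = 1)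
    (h : ι → ℝ → ℂ) (i : ι) (s : ℝ) :
    delaySolution hδ hℓ M N h i (s + ℓ i) = ∑ j, M i j * delaySolution hδ hℓ M N h j s := by
  rcases lt_or_ge s 0 with hs | hs
  · have e : ∀ j, delaySolution hδ hℓ M N h j s
        = (N.mulVec fun k => delaySolution hδ hℓ M N h k (s + ℓ k)) j := by
      intro j
      rw [delaySolution, dif_pos hs]
      apply Finset.sum_congr rfl
      intro k _
      by_cases hk : s + ℓ k < 0
      · rw [dif_pos hk]
      · rw [dif_neg hk]
        exact congrArg (N j k * ·)
          (delaySolution_of_mem hδ hℓ h (not_lt.1 hk) (by linarith)).symm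
    have e2 : ∑ j, M i j * delaySolution hδ hℓ M N h j s
        = M.mulVec (N.mulVec fun k => delaySolution hδ hℓ M N h k (s + ℓ k)) i := by
      simp only [e]
      rfl
    rw [e2, Matrix.mulVec_mulVec, hMN, Matrix.one_mulVec]
  · have := hℓ i
    rw [delaySolution, dif_neg (by linarith), dif_neg (by linarith), add_sub_cancel_right]

theorem delay_backward [DecidableEq ι] (hNM : N * M = 1) {v : ι → ℝ → ℂ}
    (hv : ∀ i s, v i (s + ℓ i) = ∑ j, M i j * v j s) (i : ι) (s : ℝ) :
    v i s = ∑ k, N i k * v k (s + ℓ k) := by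
  have e : (fun k => v k (s + ℓ k)) = M.mulVec fun j => v j s := funext fun k => hv k s
  have e2 : ∑ k, N i k * v k (s + ℓ k) = N.mulVec (fun k => v k (s + ℓ k)) i := rfl
  rw [e2, e, Matrix.mulVec_mulVec, hNM, Matrix.one_mulVec]

/-- Near the interval `[0, ℓ i)` a solution of a delay system is expressed by its values on the
fundamental intervals. -/
theorem delay_window [DecidableEq ι] (hℓ : ∀ i, δ ≤ ℓ i) (hNM : N * M = 1)
    {v : ι → ℝ → ℂ} (hv : ∀ i s, v i (s + ℓ i) = ∑ j, M i j * v j s) (i : ι) {t : ℝ}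
    (h0 : -δ ≤ t) (h1 : t < ℓ i + δ) :
    v i t = (Ico 0 (ℓ i)).indicator (v i) t
      + ∑ j, (M i j * (Ico 0 (ℓ j)).indicator (v j) (t - ℓ i)
        + N i j * (Ico 0 (ℓ j)).indicator (v j) (t + ℓ j)) := by
  -- Before, inside and after `[0, ℓ i)` exactly one of the three kinds of terms survives. Since `δ
  -- ≤ ℓ j` for all `j`, one step with `N` or `M` lands in the fundamental intervals.
  rcases lt_or_ge t 0 with ht | ht
  · rw [indicator_of_notMem (fun h => by linarith [h.1]), zero_add, delay_backward hNM hv]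
    apply Finset.sum_congr rfl
    intro j _
    rw [indicator_of_notMem (fun h => by linarith [h.1, hℓ i]),
      indicator_of_mem (show t + ℓ j ∈ Ico 0 (ℓ j) from ⟨by linarith [hℓ j], by linarith⟩)]
    ring
  · rcases lt_or_ge t (ℓ i) with ht' | ht'
    · rw [indicator_of_mem (show t ∈ Ico 0 (ℓ i) from ⟨ht, ht'⟩), Finset.sum_eq_zero, add_zero]
      intro j _
      rw [indicator_of_notMem (fun h => by linarith [h.1]),
        indicator_of_notMem (fun h => by linarith [h.2])]
      ring
    · rw [indicator_of_notMem (fun h => by linarith [h.2]), zero_add]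
      have e := hv i (t - ℓ i)
      rw [sub_add_cancel] at e
      rw [e]
      apply Finset.sum_congr rfl
      intro j _
      rw [indicator_of_mem (s := Ico 0 (ℓ j)) (a := t - ℓ i)
        ⟨by linarith, by linarith [hℓ j]⟩,
        indicator_of_notMem (fun h => by linarith [h.2])]
      ring

end Delay

/-! ### Incoming and outgoing boundary values -/

section Boundary

variable {ι : Type*} [Fintype ι] [DecidableEq ι]

/-- A block triangular matrix that agrees with the identity on the columns in `P` and with
`-S` on the other columns is invertible if the corresponding diagonal block of `S` is. -/
theorem isUnit_of_block {S A : Matrix ι ι ℂ} (P : ι → Prop) [DecidablePred P]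
    (hS : IsUnit (S.toSquareBlockProp fun i => ¬ P i))
    (hA : ∀ i j, A i j = (if P j then (if i = j then 1 else 0) else - S i j)) : IsUnit A := by
  rw [Matrix.isUnit_iff_isUnit_det, Matrix.twoBlockTriangular_det A P fun i hi j hj => by
    rw [hA, if_pos hj, if_neg (by rintro rfl; exact hi hj)]]
  have e1 : A.toSquareBlockProp P = 1 := by
    ext i j
    rw [Matrix.toSquareBlockProp_def, Matrix.of_apply, hA, if_pos j.2, Matrix.one_apply]
    simp only [Subtype.ext_iff]
  have e2 : (A.toSquareBlockProp fun i => ¬ P i) = - S.toSquareBlockProp fun i => ¬ P i := by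
    ext i j
    rw [Matrix.toSquareBlockProp_def, Matrix.of_apply, hA, if_neg j.2]
    rfl
  rw [e1, e2, Matrix.det_one, one_mul, ← Matrix.isUnit_iff_isUnit_det]
  exact hS.neg

/-- The linear relation `q = S p` between the values `p` and `q` at the two end points,
solved for the incoming values in terms of the outgoing ones. -/
theorem exists_scattering (P : ι → Prop) [DecidablePred P] (S : Matrix ι ι ℂ)
    (hpos : IsUnit (S.toSquareBlockProp P)) (hneg : IsUnit (S.toSquareBlockProp fun i => ¬ P i)) :
    ∃ M N : Matrix ι ι ℂ, M * N = 1 ∧ N * M = 1 ∧ ∀ p q : ι → ℂ,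
      q = S.mulVec p ↔ (fun i => if P i then q i else p i)
        = M.mulVec fun i => if P i then p i else q i := by
  -- The relation reads `q - S p = A inn + B out`, where `A` collects the columns of the incoming
  -- and `B` those of the outgoing values. The block of `S` on `¬ P` makes `A` invertible, the block
  -- on `P` makes `B` invertible; hence `M = -A⁻¹B` and `N = -B⁻¹A`.
  set A : Matrix ι ι ℂ := Matrix.of fun i j => if P j then (if i = j then 1 else 0) else - S i j
    with hA
  set B : Matrix ι ι ℂ := Matrix.of fun i j => if ¬ P j then (if i = j then 1 else 0) else - S i j
    with hB
  have hAu : IsUnit A.det := (Matrix.isUnit_iff_isUnit_det _).1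
    (isUnit_of_block P hneg fun _ _ => rfl)
  have hpos' : IsUnit (S.toSquareBlockProp fun i => ¬ ¬ P i) := by
    rw [Matrix.isUnit_iff_isUnit_det] at hpos ⊢
    rwa [Matrix.equiv_block_det S (q := P) fun x => not_not.symm]
  have hBu : IsUnit B.det := (Matrix.isUnit_iff_isUnit_det _).1
    (isUnit_of_block (fun i => ¬ P i) hpos' fun _ _ => rfl)
  refine ⟨- (A⁻¹ * B), - (B⁻¹ * A), ?_, ?_, fun p q => ?_⟩
  · rw [neg_mul_neg, Matrix.mul_assoc, Matrix.mul_nonsing_inv_cancel_left _ _ hBu,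
      Matrix.nonsing_inv_mul _ hAu]
  · rw [neg_mul_neg, Matrix.mul_assoc, Matrix.mul_nonsing_inv_cancel_left _ _ hAu,
      Matrix.nonsing_inv_mul _ hBu]
  set inn : ι → ℂ := fun i => if P i then q i else p i with hinn
  set out : ι → ℂ := fun i => if P i then p i else q i with hout
  have key : q - S.mulVec p = A.mulVec inn + B.mulVec out := by
    ext i
    simp only [Pi.sub_apply, Pi.add_apply, Matrix.mulVec, dotProduct, ← Finset.sum_add_distrib]
    have : q i = ∑ j, if i = j then q j else 0 := by simp
    rw [this, ← Finset.sum_sub_distrib]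
    apply Finset.sum_congr rfl
    intro j _
    simp only [hA, hB, hinn, hout, Matrix.of_apply]
    by_cases hj : P j <;> by_cases hij : i = j <;> simp [hj, hij] <;> ring
  rw [← sub_eq_zero, key]
  constructor
  · intro h
    have h' : A.mulVec inn = - B.mulVec out := eq_neg_of_add_eq_zero_left h
    have := congrArg (A⁻¹).mulVec h'
    rw [Matrix.mulVec_mulVec, Matrix.nonsing_inv_mul _ hAu, Matrix.one_mulVec] at this
    rw [this, Matrix.mulVec_neg, Matrix.mulVec_mulVec, Matrix.neg_mulVec]
  · intro h
    rw [h, Matrix.neg_mulVec, Matrix.mulVec_neg, Matrix.mulVec_mulVec, ← Matrix.mul_assoc,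
      Matrix.mul_nonsing_inv _ hAu, Matrix.one_mul, neg_add_cancel]

end Boundary

/-! ### Solutions of the first order system along characteristics -/

section Characteristics

variable {ι : Type*}

/-- The functions `w i` are defined on the whole line, `w i (x + a i * t)` solves the transport
equation with speed `a i`, and the boundary condition `w(β) = S w(α)` holds at all times. -/
def IsCharSolution [Fintype ι] (α β : ℝ) (a : ι → ℝ) (S : Matrix ι ι ℂ) (w : ι → ℝ → ℂ) : Prop :=
  ∀ i t, w i (β + a i * t) = ∑ j, S i j * w j (α + a j * t)

/-- The interval `[α, β]` without the end point through which the `i`-th component enters. -/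
def charDomain (α β : ℝ) (a : ι → ℝ) (i : ι) : Set ℝ :=
  if 0 < a i then Ico α β else Ioc α β

/-- The end point through which the `i`-th component leaves the interval. -/
def exitPoint (α β : ℝ) (a : ι → ℝ) (i : ι) : ℝ := if 0 < a i then α else β

/-- The time the `i`-th component needs to cross the interval. -/
def crossingTime (α β : ℝ) (a : ι → ℝ) (i : ι) : ℝ := (β - α) / |a i|

variable {α β : ℝ} {a : ι → ℝ}

theorem Ioo_subset_charDomain (i : ι) : Ioo α β ⊆ charDomain α β a i := by
  unfold charDomain
  split_ifs
  exacts [Ioo_subset_Ico_self, Ioo_subset_Ioc_self]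

theorem crossingTime_pos (hαβ : α < β) (ha : ∀ i, a i ≠ 0) (i : ι) : 0 < crossingTime α β a i :=
  div_pos (sub_pos.2 hαβ) (abs_pos.2 (ha i))

/-- With time counted from the exit point, the entry point is reached exactly at the crossing time.
Removing it makes `charDomain` match the half-open initial interval of the delay system. -/
theorem mem_charDomain_iff (ha : ∀ i, a i ≠ 0) (i : ι) (s : ℝ) :
    exitPoint α β a i + a i * s ∈ charDomain α β a i ↔ s ∈ Ico 0 (crossingTime α β a i) := by
  unfold exitPoint charDomain crossingTime
  rcases (ha i).lt_or_gt with h | h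
  · rw [if_neg h.not_gt, if_neg h.not_gt, abs_of_neg h, mem_Ioc, mem_Ico, lt_div_iff₀ (by linarith)]
    constructor
    · rintro ⟨h1, h2⟩
      exact ⟨by by_contra hs; nlinarith, by linarith⟩
    · rintro ⟨h1, h2⟩
      exact ⟨by linarith, by nlinarith⟩
  · rw [if_pos h, if_pos h, abs_of_pos h, mem_Ico, mem_Ico, lt_div_iff₀ h]
    constructor
    · rintro ⟨h1, h2⟩
      exact ⟨by by_contra hs; nlinarith, by linarith⟩
    · rintro ⟨h1, h2⟩
      exact ⟨by nlinarith, by linarith⟩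

theorem exitPoint_add_crossing (ha : ∀ i, a i ≠ 0) (i : ι) :
    exitPoint α β a i + a i * crossingTime α β a i = if 0 < a i then β else α := by
  unfold exitPoint crossingTime
  rcases (ha i).lt_or_gt with h | h
  · rw [if_neg h.not_gt, if_neg h.not_gt, abs_of_neg h]
    have := h.ne
    field_simp
    ring
  · rw [if_pos h, if_pos h, abs_of_pos h]
    field_simp
    ring

theorem exists_le_crossingTime [Finite ι] (hαβ : α < β) (ha : ∀ i, a i ≠ 0) :
    ∃ δ > 0, ∀ i, δ ≤ crossingTime α β a i := by
  rcases isEmpty_or_nonempty ι with h | h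
  · exact ⟨1, one_pos, fun i => h.elim i⟩
  · obtain ⟨i, hi⟩ := Finite.exists_min (crossingTime α β a)
    exact ⟨_, crossingTime_pos hαβ ha i, hi⟩

variable [Fintype ι] {S : Matrix ι ι ℂ}

/-- Along characteristics the boundary condition becomes a delay system. -/
theorem isCharSolution_iff (ha : ∀ i, a i ≠ 0) {M : Matrix ι ι ℂ}
    (hM : ∀ p q : ι → ℂ, q = S.mulVec p ↔ (fun i => if 0 < a i then q i else p i)
        = M.mulVec fun i => if 0 < a i then p i else q i) (w : ι → ℝ → ℂ) :
    IsCharSolution α β a S w ↔ ∀ i s,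
      w i (exitPoint α β a i + a i * (s + crossingTime α β a i))
        = ∑ j, M i j * w j (exitPoint α β a j + a j * s) := by
  have h1 : IsCharSolution α β a S w ↔ ∀ s, (fun i => w i (β + a i * s))
      = S.mulVec fun j => w j (α + a j * s) :=
    ⟨fun h s => funext fun i => h i s, fun h i s => congrFun (h s) i⟩
  -- The incoming values at time `s` are one crossing time later on the clock started at the exit
  -- point; the outgoing values in `h3` are at time `s` itself.
  have h2 : ∀ s, (fun i => if 0 < a i then w i (β + a i * s) else w i (α + a i * s))
      = fun i => w i (exitPoint α β a i + a i * (s + crossingTime α β a i)) := by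
    intro s
    ext i
    have e : exitPoint α β a i + a i * (s + crossingTime α β a i)
        = (exitPoint α β a i + a i * crossingTime α β a i) + a i * s := by ring
    rw [e, exitPoint_add_crossing ha]
    split_ifs <;> rfl
  have h3 : ∀ s, (fun i => if 0 < a i then w i (α + a i * s) else w i (β + a i * s))
      = fun i => w i (exitPoint α β a i + a i * s) := by
    intro s
    ext i
    unfold exitPoint
    split_ifs <;> rfl
  rw [h1]
  simp_rw [hM, h2, h3]
  exact ⟨fun h i s => congrFun (h s) i, fun h s => funext fun i => h i s⟩

variable [DecidableEq ι]

/-- Every function on the interval extends to a solution. -/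
theorem exists_isCharSolution (hαβ : α < β) (ha : ∀ i, a i ≠ 0)
    (hpos : IsUnit (S.toSquareBlockProp fun i => 0 < a i))
    (hneg : IsUnit (S.toSquareBlockProp fun i => ¬ 0 < a i)) (g : ι → ℝ → ℂ) :
    ∃ w, IsCharSolution α β a S w ∧ ∀ i, EqOn (w i) (g i) (charDomain α β a i) := by
  obtain ⟨M, N, hMN, -, hM⟩ := exists_scattering (fun i => 0 < a i) S hpos hneg
  obtain ⟨δ, hδ, hℓ⟩ := exists_le_crossingTime hαβ ha
  set v := delaySolution hδ hℓ M N fun i s => g i (exitPoint α β a i + a i * s) with hv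
  have e : ∀ i s, exitPoint α β a i + a i * s - exitPoint α β a i = a i * s := fun i s => by ring
  have e2 : ∀ i x, exitPoint α β a i + a i * ((x - exitPoint α β a i) / a i) = x := fun i x => by
    rw [mul_div_cancel₀ _ (ha i), add_sub_cancel]
  refine ⟨fun i x => v i ((x - exitPoint α β a i) / a i), ?_, fun i x hx => ?_⟩
  · rw [isCharSolution_iff ha hM]
    intro i s
    simp only [e, mul_div_cancel_left₀ _ (ha _)]
    exact delaySolution_add hδ hℓ hMN _ i s
  · rw [← e2 i x, mem_charDomain_iff ha] at hx
    change v i _ = _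
    rw [hv, delaySolution_of_mem hδ hℓ _ hx.1 hx.2, e2]

/-- For short times a solution is an explicit combination of affine reparametrizations of its
restriction to the interval. -/
theorem exists_window_formula (hαβ : α < β) (ha : ∀ i, a i ≠ 0)
    (hpos : IsUnit (S.toSquareBlockProp fun i => 0 < a i))
    (hneg : IsUnit (S.toSquareBlockProp fun i => ¬ 0 < a i)) :
    ∃ δ > 0, ∃ (M N : Matrix ι ι ℂ) (q r : ι → ι → ℝ), ∀ w, IsCharSolution α β a S w →
      ∀ i t x, |t| ≤ δ → x ∈ charDomain α β a i →
        w i (x + a i * t) = (charDomain α β a i).indicator (w i) (x + a i * t)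
          + ∑ j, (M i j * (charDomain α β a j).indicator (w j)
              (a j / a i * (x + a i * t) + q i j)
            + N i j * (charDomain α β a j).indicator (w j)
              (a j / a i * (x + a i * t) + r i j)) := by
  obtain ⟨M, N, -, hNM, hM⟩ := exists_scattering (fun i => 0 < a i) S hpos hneg
  obtain ⟨δ, hδ, hℓ⟩ := exists_le_crossingTime hαβ ha
  refine ⟨δ, hδ, M, N,
    -- With `y = exitPoint i + a i * s`, the points `exitPoint j + a j * (s - crossingTime i)` and
    -- `exitPoint j + a j * (s + crossingTime j)` are affine in `y` with slope `a j / a i`; these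
    -- are their constant terms.
    fun i j => exitPoint α β a j - a j / a i * exitPoint α β a i - a j * crossingTime α β a i,
    fun i j => exitPoint α β a j - a j / a i * exitPoint α β a i + a j * crossingTime α β a j,
    fun w hw i t x ht hx => ?_⟩
  rw [isCharSolution_iff ha hM] at hw
  set s := (x - exitPoint α β a i) / a i with hs
  have hxs : x = exitPoint α β a i + a i * s := by
    rw [hs, mul_div_cancel₀ _ (ha i), add_sub_cancel]
  rw [hxs, mem_charDomain_iff ha] at hx
  have key := delay_window hℓ hNM (v := fun i s => w i (exitPoint α β a i + a i * s)) hw i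
    (t := s + t) (by linarith [hx.1, neg_abs_le t]) (by linarith [hx.2, le_abs_self t])
  have hind : ∀ j u y, y = exitPoint α β a j + a j * u →
      (Ico 0 (crossingTime α β a j)).indicator
        (fun s => w j (exitPoint α β a j + a j * s)) u
      = (charDomain α β a j).indicator (w j) y := by
    rintro j u _ rfl
    classical
    rw [indicator_apply, indicator_apply, if_congr (mem_charDomain_iff ha j u) rfl rfl]
  have hx' : x + a i * t = exitPoint α β a i + a i * (s + t) := by rw [hxs]; ring
  have hai := ha i
  rw [hx', key, hind i (s + t) _ rfl]
  congr 1
  apply Finset.sum_congr rfl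
  intro j _
  rw [hind j (s + t - crossingTime α β a i), hind j (s + t + crossingTime α β a j)]
  · field_simp
    ring
  · field_simp
    ring

end Characteristics

/-! ### Operators between `L²` spaces -/

section Operators

/-- A bounded linear operation on functions that respects almost everywhere equality acts as a
bounded operator on `L²`. -/
theorem exists_Lp_clm {X Y : Type*} [MeasurableSpace X] [MeasurableSpace Y] {μ : Measure X}
    {ν : Measure Y} (Φ : (X → ℂ) → Y → ℂ) (hadd : ∀ u v, Φ (u + v) = Φ u + Φ v)
    (hsmul : ∀ (c : ℂ) u, Φ (c • u) = c • Φ u) (hae : ∀ u v, u =ᵐ[μ] v → Φ u =ᵐ[ν] Φ v)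
    (hm : ∀ u, MemLp u 2 μ → MemLp (Φ u) 2 ν) (C : NNReal)
    (hC : ∀ u, MemLp u 2 μ → eLpNorm (Φ u) 2 ν ≤ C * eLpNorm u 2 μ) :
    ∃ B : Lp ℂ 2 μ →L[ℂ] Lp ℂ 2 ν, ∀ u : Lp ℂ 2 μ, B u =ᵐ[ν] Φ u := by
  let B₀ : Lp ℂ 2 μ →ₗ[ℂ] Lp ℂ 2 ν :=
    { toFun := fun u => (hm u (Lp.memLp u)).toLp (Φ u)
      map_add' := by
        intro u v
        rw [← MemLp.toLp_add, MemLp.toLp_eq_toLp_iff, ← hadd]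
        exact hae _ _ (Lp.coeFn_add u v)
      map_smul' := by
        intro c u
        rw [RingHom.id_apply, ← MemLp.toLp_const_smul, MemLp.toLp_eq_toLp_iff, ← hsmul]
        exact hae _ _ (Lp.coeFn_smul c u) }
  refine ⟨B₀.mkContinuous C fun u => ?_, fun u => MemLp.coeFn_toLp (hm u (Lp.memLp u))⟩
  change ‖(hm u (Lp.memLp u)).toLp (Φ u)‖ ≤ _
  rw [Lp.norm_toLp, Lp.norm_def, ← ENNReal.coe_toReal, ← ENNReal.toReal_mul]
  exact ENNReal.toReal_mono (ENNReal.mul_ne_top (by simp) (Lp.memLp u).2.ne) (hC u (Lp.memLp u))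

theorem quasiMeasurePreserving_affine {p : ℝ} (hp : p ≠ 0) (q : ℝ) :
    Measure.QuasiMeasurePreserving (fun x : ℝ => p * x + q) volume volume := by
  refine ⟨by fun_prop, ?_⟩
  have h1 : (fun x : ℝ => p * x + q) = (fun x => x + q) ∘ fun x => p * x := rfl
  rw [h1, ← Measure.map_map (by fun_prop) (by fun_prop), Real.map_volume_mul_left hp,
    Measure.map_smul, map_add_right_eq_self]
  exact Measure.smul_absolutelyContinuous

theorem exists_affine_clm {p : ℝ} (hp : p ≠ 0) (q : ℝ) :
    ∃ B : Lp ℂ 2 (volume : Measure ℝ) →L[ℂ] Lp ℂ 2 (volume : Measure ℝ),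
      ∀ u : Lp ℂ 2 (volume : Measure ℝ), B u =ᵐ[volume] fun x => u (p * x + q) := by
  have hmap : Measure.map (fun x : ℝ => p * x + q) volume = ENNReal.ofReal |p⁻¹| • volume := by
    have h1 : (fun x : ℝ => p * x + q) = (fun x => x + q) ∘ fun x => p * x := rfl
    rw [h1, ← Measure.map_map (by fun_prop) (by fun_prop), Real.map_volume_mul_left hp,
      Measure.map_smul, map_add_right_eq_self]
  have hq := quasiMeasurePreserving_affine hp q
  have hnorm : ∀ u : ℝ → ℂ, MemLp u 2 → eLpNorm (fun x => u (p * x + q)) 2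
      = ENNReal.ofReal |p⁻¹| ^ (1 / (2 : ENNReal)).toReal • eLpNorm u 2 := by
    intro u hu
    have e := eLpNorm_map_measure (p := 2) (g := u) (μ := volume) (f := fun x : ℝ => p * x + q)
      (hu.1.mono_ac hq.absolutelyContinuous) (by fun_prop)
    rw [hmap, eLpNorm_smul_measure_of_ne_top (by simp)] at e
    exact e.symm
  have hfin : ENNReal.ofReal |p⁻¹| ^ (1 / (2 : ENNReal)).toReal ≠ ⊤ :=
    ENNReal.rpow_ne_top_of_nonneg (by positivity) ENNReal.ofReal_ne_top
  refine exists_Lp_clm (fun u x => u (p * x + q)) (fun _ _ => rfl) (fun _ _ => rfl)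
    (fun u v h => hq.ae_eq_comp h) (fun u hu => ⟨hu.1.comp_quasiMeasurePreserving hq, ?_⟩)
    (ENNReal.ofReal |p⁻¹| ^ (1 / (2 : ENNReal)).toReal).toNNReal fun u hu => ?_
  · rw [hnorm u hu]
    exact ENNReal.mul_lt_top hfin.lt_top hu.2
  · rw [hnorm u hu, ENNReal.coe_toNNReal hfin, smul_eq_mul]

theorem exists_extension_by_zero_clm {X : Type*} [MeasurableSpace X] {μ : Measure X} {s : Set X}
    (hs : MeasurableSet s) :
    ∃ B : Lp ℂ 2 (μ.restrict s) →L[ℂ] Lp ℂ 2 μ,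
      ∀ u : Lp ℂ 2 (μ.restrict s), B u =ᵐ[μ] s.indicator u := by
  refine exists_Lp_clm (fun u => s.indicator u) (fun _ _ => indicator_add' _ _ _)
    (fun c u => indicator_const_smul s c u) (fun u v h => ?_)
    (fun u hu => (memLp_indicator_iff_restrict hs).2 hu) 1 fun u hu => ?_
  · exact (ae_eq_restrict_iff_indicator_ae_eq hs).1 h
  · rw [eLpNorm_indicator_eq_eLpNorm_restrict hs, ENNReal.coe_one, one_mul]

end Operators

/-! ### Components of vector-valued `L²` functions -/

section Components

variable {X : Type*} [MeasurableSpace X] {μ : Measure X} {n : ℕ}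

theorem eLpNorm_component_le (f : X → EuclideanSpace ℂ (Fin n)) (i : Fin n) :
    eLpNorm (fun x => f x i) 2 μ ≤ eLpNorm f 2 μ :=
  eLpNorm_mono fun x => PiLp.norm_apply_le (f x) i

theorem eLpNorm_le_sum_component {f : X → EuclideanSpace ℂ (Fin n)}
    (hf : ∀ i, AEStronglyMeasurable (fun x => f x i) μ) :
    eLpNorm f 2 μ ≤ ∑ i, eLpNorm (fun x => f x i) 2 μ := by
  have e : f = ∑ i, fun x => EuclideanSpace.single i (f x i) := by
    ext x k
    simp [Finset.sum_apply]
  conv_lhs => rw [e]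
  refine (eLpNorm_sum_le (fun i _ => ?_) (by norm_num)).trans (Finset.sum_le_sum fun i _ => ?_)
  · have h : (fun x => EuclideanSpace.single i (f x i) : X → EuclideanSpace ℂ (Fin n))
        = fun x => f x i • EuclideanSpace.single i (1 : ℂ) := by
      ext x k
      simp
    rw [h]
    exact (hf i).smul_const _
  · exact eLpNorm_mono fun x => by simp

theorem aestronglyMeasurable_component (f : Lp (EuclideanSpace ℂ (Fin n)) 2 μ) (i : Fin n) :
    AEStronglyMeasurable (fun x => f x i) μ :=
  (EuclideanSpace.proj (𝕜 := ℂ) i).continuous.comp_aestronglyMeasurable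
    (Lp.aestronglyMeasurable f)

theorem tendsto_of_tendsto_component {T : Type*} {l : Filter T}
    {F : T → Lp (EuclideanSpace ℂ (Fin n)) 2 μ} {g : Lp (EuclideanSpace ℂ (Fin n)) 2 μ}
    (h : ∀ i, Tendsto (fun s => eLpNorm (fun x => F s x i - g x i) 2 μ) l (𝓝 0)) :
    Tendsto F l (𝓝 g) := by
  rw [tendsto_iff_edist_tendsto_0]
  have hs : Tendsto (fun s => ∑ i, eLpNorm (fun x => F s x i - g x i) 2 μ) l (𝓝 0) := by
    simpa using tendsto_finsetSum Finset.univ fun i _ => h i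
  refine tendsto_of_tendsto_of_tendsto_of_le_of_le tendsto_const_nhds hs (fun _ => zero_le)
    fun s => ?_
  dsimp only
  rw [Lp.edist_def]
  refine eLpNorm_le_sum_component (f := ⇑(F s) - ⇑g) fun i => ?_
  exact (aestronglyMeasurable_component _ i).sub (aestronglyMeasurable_component _ i)

theorem tendsto_component {T : Type*} {l : Filter T}
    {F : T → Lp (EuclideanSpace ℂ (Fin n)) 2 μ} {g : Lp (EuclideanSpace ℂ (Fin n)) 2 μ}
    (h : Tendsto F l (𝓝 g)) (i : Fin n) :
    Tendsto (fun s => eLpNorm (fun x => F s x i - g x i) 2 μ) l (𝓝 0) := by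
  rw [tendsto_iff_edist_tendsto_0] at h
  refine tendsto_of_tendsto_of_tendsto_of_le_of_le tendsto_const_nhds h (fun _ => zero_le)
    fun s => ?_
  dsimp only
  rw [Lp.edist_def]
  exact eLpNorm_component_le (⇑(F s) - ⇑g) i

theorem exists_component_clm (i : Fin n) :
    ∃ B : Lp (EuclideanSpace ℂ (Fin n)) 2 μ →L[ℂ] Lp ℂ 2 μ, ∀ f, B f =ᵐ[μ] fun x => f x i :=
  ⟨(EuclideanSpace.proj (𝕜 := ℂ) i).compLpL 2 μ, fun f =>
    ContinuousLinearMap.coeFn_compLpL _ f⟩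

theorem exists_assemble_clm {G : Type*} [NormedAddCommGroup G] [NormedSpace ℂ G]
    (C : Fin n → G →L[ℂ] Lp ℂ 2 μ) :
    ∃ B : G →L[ℂ] Lp (EuclideanSpace ℂ (Fin n)) 2 μ,
      ∀ f i, (fun x => B f x i) =ᵐ[μ] C i f := by
  let J : Fin n → Lp ℂ 2 μ →L[ℂ] Lp (EuclideanSpace ℂ (Fin n)) 2 μ := fun i =>
    (ContinuousLinearMap.toSpanSingleton ℂ (EuclideanSpace.single i (1 : ℂ))).compLpL 2 μ
  have hJ : ∀ i u, J i u =ᵐ[μ] fun x => u x • EuclideanSpace.single i (1 : ℂ) := fun i u =>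
    ContinuousLinearMap.coeFn_compLpL _ u
  refine ⟨∑ i, (J i).comp (C i), fun f i => ?_⟩
  have e : (∑ i, (J i).comp (C i)) f = ∑ i, J i (C i f) := by simp
  rw [e]
  have h1 := Lp.coeFn_finsetSum Finset.univ (fun i => J i (C i f))
  have h2 : ∀ᵐ x ∂μ, ∀ i, J i (C i f) x = (C i f) x • EuclideanSpace.single i (1 : ℂ) :=
    ae_all_iff.2 fun i => hJ i (C i f)
  filter_upwards [h1, h2] with x hx1 hx2
  rw [hx1, Finset.sum_apply]
  simp [hx2, Pi.single_apply]

end Components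

/-! ### The group -/

section Group

variable {α β : ℝ} {n : ℕ} {a : Fin n → ℝ} {S : Matrix (Fin n) (Fin n) ℂ}

/-- The solution `w` has initial values `f`. -/
def IsExtension (a : Fin n → ℝ) (S : Matrix (Fin n) (Fin n) ℂ) (f : L2Interval α β n)
    (w : Fin n → ℝ → ℂ) : Prop :=
  IsCharSolution α β a S w ∧ ∀ i, ∀ᵐ x ∂volume.restrict (Ioo α β), f x i = w i x

/-- The solution at time `t`, moved along the characteristics. -/
def charTranslate (a : Fin n → ℝ) (w : Fin n → ℝ → ℂ) (t : ℝ) (i : Fin n) (x : ℝ) : ℂ :=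
  w i (x + a i * t)

theorem charTranslate_charTranslate (w : Fin n → ℝ → ℂ) (s t : ℝ) :
    charTranslate a (charTranslate a w t) s = charTranslate a w (s + t) := by
  ext i x
  unfold charTranslate
  congr 1
  ring

theorem charTranslate_zero (w : Fin n → ℝ → ℂ) : charTranslate a w 0 = w := by
  ext i x
  simp [charTranslate]

theorem IsCharSolution.translate {w : Fin n → ℝ → ℂ} (hw : IsCharSolution α β a S w) (t : ℝ) :
    IsCharSolution α β a S (charTranslate a w t) := by
  intro i s
  have := hw i (s + t)
  simpa only [charTranslate, mul_add, add_assoc] using this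

/-- Lets identities between operators be checked on extensions, where they become identities between
translations. -/
theorem IsExtension.unique {f g : L2Interval α β n} {w : Fin n → ℝ → ℂ}
    (hf : IsExtension a S f w) (hg : IsExtension a S g w) : f = g := by
  apply Lp.ext
  filter_upwards [ae_all_iff.2 hf.2, ae_all_iff.2 hg.2] with x h1 h2
  ext i
  rw [h1, h2]

theorem ae_restrict_translate {p : ℝ → Prop} (h : ∀ᵐ x, p x) (c : ℝ) (s : Set ℝ) :
    ∀ᵐ x ∂volume.restrict s, p (x + c) :=
  ae_restrict_of_ae ((measurePreserving_add_right volume c).quasiMeasurePreserving.ae h)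

variable (hαβ : α < β) (ha : ∀ i, a i ≠ 0) (hpos : IsUnit (S.toSquareBlockProp fun i => 0 < a i))
  (hneg : IsUnit (S.toSquareBlockProp fun i => ¬ 0 < a i))

include hαβ ha hpos hneg

theorem exists_isExtension (f : L2Interval α β n) : ∃ w, IsExtension a S f w := by
  obtain ⟨w, hw, h⟩ := exists_isCharSolution hαβ ha hpos hneg fun i x => f x i
  refine ⟨w, hw, fun i => ?_⟩
  filter_upwards [ae_restrict_mem measurableSet_Ioo] with x hx
  exact (h i (Ioo_subset_charDomain i hx)).symm

/-- Near the interval, solutions are given by bounded operators into `L²` of the line. -/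
theorem exists_window_clm :
    ∃ δ > 0, ∃ W : Fin n → L2Interval α β n →L[ℂ] Lp ℂ 2 (volume : Measure ℝ),
    ∀ f w, IsExtension a S f w → ∀ i, ∀ᵐ y, ∀ x ∈ Ioo α β, ∀ t, |t| ≤ δ → x + a i * t = y →
      W i f y = w i y := by
  obtain ⟨δ, hδ, M, N, q, r, hwin⟩ := exists_window_formula hαβ ha hpos hneg
  obtain ⟨Z, hZ⟩ := exists_extension_by_zero_clm (μ := (volume : Measure ℝ))
    (measurableSet_Ioo (a := α) (b := β))
  choose C hC using fun i : Fin n => exists_component_clm (μ := volume.restrict (Ioo α β)) i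
  choose Q hQ using fun i j : Fin n => exists_affine_clm (div_ne_zero (ha j) (ha i)) (q i j)
  choose R hR using fun i j : Fin n => exists_affine_clm (div_ne_zero (ha j) (ha i)) (r i j)
  have hE : ∀ f w, IsExtension a S f w → ∀ j,
      Z (C j f) =ᵐ[volume] (charDomain α β a j).indicator (w j) := by
    intro f w hfw j
    have h1 : C j f =ᵐ[volume.restrict (Ioo α β)] w j := (hC j f).trans (hfw.2 j)
    refine (hZ _).trans (((ae_eq_restrict_iff_indicator_ae_eq measurableSet_Ioo).1 h1).trans ?_)
    apply indicator_ae_eq_of_ae_eq_set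
    unfold charDomain
    split_ifs
    exacts [Ioo_ae_eq_Ico, Ioo_ae_eq_Ioc]
  refine ⟨δ, hδ, fun i => Z.comp (C i) + ∑ j, (M i j • (Q i j).comp (Z.comp (C j))
    + N i j • (R i j).comp (Z.comp (C j))), fun f w hfw i => ?_⟩
  have hQ' : ∀ j, Q i j (Z (C j f)) =ᵐ[volume] fun x =>
      (charDomain α β a j).indicator (w j) (a j / a i * x + q i j) := fun j =>
    (hQ i j _).trans ((quasiMeasurePreserving_affine (div_ne_zero (ha j) (ha i)) _).ae_eq_comp
      (hE f w hfw j))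
  have hR' : ∀ j, R i j (Z (C j f)) =ᵐ[volume] fun x =>
      (charDomain α β a j).indicator (w j) (a j / a i * x + r i j) := fun j =>
    (hR i j _).trans ((quasiMeasurePreserving_affine (div_ne_zero (ha j) (ha i)) _).ae_eq_comp
      (hE f w hfw j))
  have e : (Z.comp (C i) + ∑ j, (M i j • (Q i j).comp (Z.comp (C j))
      + N i j • (R i j).comp (Z.comp (C j)))) f = Z (C i f) + ∑ j, (M i j • Q i j (Z (C j f))
      + N i j • R i j (Z (C j f))) := by
    simp
  have key : ∀ᵐ y, (Z (C i f) + ∑ j, (M i j • Q i j (Z (C j f))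
      + N i j • R i j (Z (C j f))) : Lp ℂ 2 (volume : Measure ℝ)) y
      = (charDomain α β a i).indicator (w i) y
        + ∑ j, (M i j * (charDomain α β a j).indicator (w j) (a j / a i * y + q i j)
          + N i j * (charDomain α β a j).indicator (w j) (a j / a i * y + r i j)) := by
    have h1 := Lp.coeFn_finsetSum Finset.univ
      (fun j => M i j • Q i j (Z (C j f)) + N i j • R i j (Z (C j f)))
    have h2 : ∀ᵐ y, ∀ j, (M i j • Q i j (Z (C j f)) + N i j • R i j (Z (C j f)) :
        Lp ℂ 2 (volume : Measure ℝ)) y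
        = M i j * (charDomain α β a j).indicator (w j) (a j / a i * y + q i j)
          + N i j * (charDomain α β a j).indicator (w j) (a j / a i * y + r i j) := by
      refine ae_all_iff.2 fun j => ?_
      filter_upwards [Lp.coeFn_add (M i j • Q i j (Z (C j f))) (N i j • R i j (Z (C j f))),
        Lp.coeFn_smul (M i j) (Q i j (Z (C j f))), Lp.coeFn_smul (N i j) (R i j (Z (C j f))),
        hQ' j, hR' j] with y h1 h2 h3 h4 h5
      rw [h1, Pi.add_apply, h2, h3, Pi.smul_apply, Pi.smul_apply, h4, h5, smul_eq_mul, smul_eq_mul]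
    filter_upwards [Lp.coeFn_add (Z (C i f)) (∑ j, (M i j • Q i j (Z (C j f))
      + N i j • R i j (Z (C j f)))), h1, h2, hE f w hfw i] with y k1 k2 k3 k4
    rw [k1, Pi.add_apply, k2, k4, Finset.sum_apply, Finset.sum_congr rfl fun j _ => k3 j]
  simp only [e]
  -- The exceptional set concerns `y` alone, so one null set serves all pairs `x`, `t`; this is
  -- needed to integrate along characteristics.
  filter_upwards [key] with y hy x hx t ht hxy
  rw [hy, ← hxy, hwin w hfw.1 i t x ht (Ioo_subset_charDomain i hx)]

theorem exists_window_clm_translate :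
    ∃ δ > 0, ∃ W : Fin n → L2Interval α β n →L[ℂ] Lp ℂ 2 (volume : Measure ℝ),
    ∀ f w, IsExtension a S f w → ∀ i t, |t| ≤ δ → ∀ᵐ x ∂volume.restrict (Ioo α β),
      W i f (x + a i * t) = w i (x + a i * t) := by
  obtain ⟨δ, hδ, W, hW⟩ := exists_window_clm hαβ ha hpos hneg
  refine ⟨δ, hδ, W, fun f w hfw i t ht => ?_⟩
  filter_upwards [ae_restrict_translate (hW f w hfw i) (a i * t) (Ioo α β),
    ae_restrict_mem measurableSet_Ioo] with x hx hx'
  exact hx x hx' t ht rfl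

/-- For `|t| ≤ δ` the window operators, translated and restricted to the interval, give the
operator; longer times are compositions of short ones. -/
theorem exists_op (t : ℝ) : ∃ B : L2Interval α β n →L[ℂ] L2Interval α β n,
    ∀ f w, IsExtension a S f w → IsExtension a S (B f) (charTranslate a w t) := by
  obtain ⟨δ, hδ, W, hW⟩ := exists_window_clm_translate hαβ ha hpos hneg
  have small : ∀ t : ℝ, |t| ≤ δ → ∃ B : L2Interval α β n →L[ℂ] L2Interval α β n,
      ∀ f w, IsExtension a S f w → IsExtension a S (B f) (charTranslate a w t) := by
    intro t ht
    choose A hA using fun i => exists_affine_clm one_ne_zero (a i * t)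
    obtain ⟨B, hB⟩ := exists_assemble_clm fun i =>
      (LpToLpRestrictCLM ℝ ℂ ℂ volume 2 (Ioo α β)).comp ((A i).comp (W i))
    refine ⟨B, fun f w hfw => ⟨hfw.1.translate t, fun i => ?_⟩⟩
    filter_upwards [hB f i, LpToLpRestrictCLM_coeFn ℂ (Ioo α β) (A i (W i f)),
      ae_restrict_of_ae (hA i (W i f)), hW f w hfw i t ht] with x h1 h2 h3 h4
    rw [h1, ContinuousLinearMap.comp_apply, ContinuousLinearMap.comp_apply, h2, h3, one_mul, h4]
    rfl
  have key : ∀ (k : ℕ) (t : ℝ), |t| ≤ k * δ → ∃ B : L2Interval α β n →L[ℂ] L2Interval α β n,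
      ∀ f w, IsExtension a S f w → IsExtension a S (B f) (charTranslate a w t) := by
    intro k
    induction k with
    | zero =>
      intro t ht
      exact small t (ht.trans (by simpa using hδ.le))
    | succ k ih =>
      intro t ht
      push_cast at ht
      have hk : (0 : ℝ) < k + 1 := by positivity
      -- One of `k + 1` equal time steps is split off; the remaining time is at most `k * δ`.
      obtain ⟨B₁, h₁⟩ := small (t / (k + 1)) (by
        rw [abs_div, abs_of_pos hk, div_le_iff₀ hk]
        linarith)
      obtain ⟨B₂, h₂⟩ := ih (t * k / (k + 1)) (by
        rw [abs_div, abs_of_pos hk, div_le_iff₀ hk, abs_mul, Nat.abs_cast]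
        nlinarith [Nat.cast_nonneg (α := ℝ) k])
      refine ⟨B₁.comp B₂, fun f w hfw => ?_⟩
      have := h₁ _ _ (h₂ f w hfw)
      rwa [charTranslate_charTranslate, show t / (k + 1) + t * k / (k + 1) = t by
        field_simp; ring] at this
  obtain ⟨k, hk⟩ := exists_nat_ge (|t| / δ)
  exact key k t ((div_le_iff₀ hδ).1 hk)

/-- The translation group along the characteristics. -/
theorem exists_group : ∃ T : C0Group (L2Interval α β n),
    ∀ t f w, IsExtension a S f w → IsExtension a S (T.op t f) (charTranslate a w t) := by
  choose B hB using exists_op hαβ ha hpos hneg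
  obtain ⟨δ, hδ, W, hW⟩ := exists_window_clm_translate hαβ ha hpos hneg
  have hadd : ∀ s t : ℝ, B (s + t) = (B s).comp (B t) := by
    intro s t
    ext1 f
    obtain ⟨w, hw⟩ := exists_isExtension hαβ ha hpos hneg f
    have h1 := hB s _ _ (hB t f w hw)
    rw [charTranslate_charTranslate] at h1
    exact (hB (s + t) f w hw).unique h1
  have hzero : B 0 = ContinuousLinearMap.id ℂ _ := by
    ext1 f
    obtain ⟨w, hw⟩ := exists_isExtension hαβ ha hpos hneg f
    have h1 := hB 0 f w hw
    rw [charTranslate_zero] at h1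
    exact h1.unique hw
  -- For small times the orbit is a translate of the fixed functions `W i f` in `L²(ℝ)`, where
  -- translation is continuous.
  have hcont : ∀ f, Tendsto (fun t => B t f) (𝓝 0) (𝓝 f) := by
    intro f
    obtain ⟨w, hw⟩ := exists_isExtension hαβ ha hpos hneg f
    apply tendsto_of_tendsto_component
    intro i
    have h1 : Tendsto (fun t => eLpNorm (fun x => W i f (x + a i * t) - W i f x) 2)
        (𝓝 0) (𝓝 0) := by
      have h2 : Tendsto (fun t => a i * t) (𝓝 0) (𝓝 0) := by
        simpa using (continuous_const_mul (a i)).tendsto 0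
      exact (tendsto_eLpNorm_translate_sub (Lp.memLp (W i f))).comp h2
    have hnear : ∀ᶠ t : ℝ in 𝓝 0, |t| ≤ δ := by
      filter_upwards [Metric.ball_mem_nhds (0 : ℝ) hδ] with t ht
      simpa using (Metric.mem_ball.1 ht).le
    refine tendsto_of_tendsto_of_tendsto_of_le_of_le' tendsto_const_nhds h1
      (Eventually.of_forall fun _ => zero_le) ?_
    filter_upwards [hnear] with t ht
    refine le_trans (le_of_eq (eLpNorm_congr_ae ?_))
      (eLpNorm_restrict_le (fun x => W i f (x + a i * t) - W i f x) 2 volume (Ioo α β))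
    filter_upwards [(hB t f w hw).2 i, hw.2 i, hW f w hw i t ht,
      hW f w hw i 0 (by simpa using hδ.le)] with x h1 h2 h3 h4
    rw [mul_zero, add_zero] at h4
    rw [h1, h2, h3, h4]
    rfl
  refine ⟨⟨B, hzero, hadd, fun f => continuous_iff_continuousAt.2 fun t₀ => ?_⟩, hB⟩
  have h1 : Tendsto (fun t => t - t₀) (𝓝 t₀) (𝓝 0) := by
    simpa using (continuous_sub_right t₀).tendsto t₀
  have h2 := ((B t₀).continuous.tendsto f).comp ((hcont f).comp h1)
  refine h2.congr fun t => ?_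
  simp only [Function.comp_apply]
  rw [← ContinuousLinearMap.comp_apply, ← hadd, add_sub_cancel]

end Group

/-! ### The generator -/

section Generator

variable {α β : ℝ} {n : ℕ} {a : Fin n → ℝ} {S : Matrix (Fin n) (Fin n) ℂ}

theorem diagMul_component (b : Fin n → ℝ) (f : L2Interval α β n) (i : Fin n) :
    ∀ᵐ x ∂volume.restrict (Ioo α β), diagMul α β b f x i = b i * f x i := by
  filter_upwards [ContinuousLinearMap.coeFn_compLpL (p := 2) (μ := volume.restrict (Ioo α β))
    (Matrix.toEuclideanCLM (𝕜 := ℂ) (Matrix.diagonal fun i => (b i : ℂ))) f] with x hx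
  rw [diagMul, hx]
  simp [Matrix.mulVec_diagonal]

theorem integrableOn_component (f : L2Interval α β n) (i : Fin n) :
    IntegrableOn (fun x => f x i) (Ioo α β) :=
  (EuclideanSpace.proj (𝕜 := ℂ) i).integrable_comp ((Lp.memLp f).integrable (by norm_num))

theorem integral_smul_component {φ : ℝ → ℝ} (hφ : Continuous φ) (hs : HasCompactSupport φ)
    (f : L2Interval α β n) (i : Fin n) :
    (∫ x in Ioo α β, φ x • f x) i = ∫ x in Ioo α β, φ x • f x i := by
  let L : EuclideanSpace ℂ (Fin n) →L[ℂ] ℂ := EuclideanSpace.proj i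
  exact (L.integral_comp_comm (integrable_smul_L2 hφ hs f)).symm

theorem isWeakDeriv_iff_component {f g : L2Interval α β n} :
    IsWeakDeriv f g ↔ ∀ i, ∀ φ : ℝ → ℝ, ContDiff ℝ ∞ φ → HasCompactSupport φ →
      tsupport φ ⊆ Ioo α β →
      ∫ x in Ioo α β, deriv φ x • f x i = - ∫ x in Ioo α β, φ x • g x i := by
  constructor
  · intro h i φ h1 h2 h3
    have e := congrArg (fun v : EuclideanSpace ℂ (Fin n) => v i) (h φ h1 h2 h3)
    simpa only [PiLp.neg_apply, integral_smul_component (h1.continuous_deriv (by simp)) h2.deriv,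
      integral_smul_component h1.continuous h2] using e
  · intro h φ h1 h2 h3
    ext i
    rw [PiLp.neg_apply, integral_smul_component (h1.continuous_deriv (by simp)) h2.deriv,
      integral_smul_component h1.continuous h2]
    exact h i φ h1 h2 h3

theorem integral_char_eq {u : ℝ → ℂ} {c : ℝ} (hc : c ≠ 0) (x t : ℝ) :
    ∫ y in x..(x + c * t), (c : ℂ)⁻¹ * u y = ∫ r in (0:ℝ)..t, u (x + c * r) := by
  rw [intervalIntegral.integral_comp_add_mul u hc, intervalIntegral.integral_const_mul]
  simp

/-- Turns a time average along a characteristic into the spatial average with step `c * t`, whose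
`L²` limit is known. -/
theorem average_char_eq {u : ℝ → ℂ} {c : ℝ} (hc : c ≠ 0) (x t : ℝ) :
    t⁻¹ • ∫ r in (0:ℝ)..t, u (x + c * r)
      = (c * t)⁻¹ • ∫ y in (0:ℝ)..(c * t), u (x + y) := by
  rw [intervalIntegral.integral_comp_mul_left (fun y => u (x + y)) hc, smul_smul, mul_zero, mul_inv,
    mul_comm]

/-- The continuous representative of a function with a weak derivative is a primitive of it. -/
theorem eqOn_primitive_of_isWeakDeriv (hαβ : α < β) {f g : L2Interval α β n} (hg : IsWeakDeriv f g)
    {F : ℝ → EuclideanSpace ℂ (Fin n)} (hF : ContinuousOn F (Icc α β))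
    (hfF : f =ᵐ[volume.restrict (Ioo α β)] F) (i : Fin n) {x : ℝ} (hx : x ∈ Icc α β) :
    F x i = F α i + ∫ y in α..x, g y i := by
  have hgi := integrableOn_component g i
  obtain ⟨c, hc⟩ := ae_eq_const_add_primitive hαβ (integrableOn_component f i) hgi
    (isWeakDeriv_iff_component.1 hg i)
  have hcont : ContinuousOn (fun x => c + ∫ y in α..x, g y i) (Icc α β) :=
    continuousOn_const.add (intervalIntegral.continuousOn_primitive_interval
      (by rw [uIcc_of_le hαβ.le]; exact hgi.congr_set_ae Ioo_ae_eq_Icc.symm)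
      |>.mono (by rw [uIcc_of_le hαβ.le]))
  have hFi : ContinuousOn (fun x => F x i) (Icc α β) :=
    (EuclideanSpace.proj (𝕜 := ℂ) i).continuous.comp_continuousOn hF
  have hae : (fun x => F x i) =ᵐ[volume.restrict (Icc α β)] fun x => c + ∫ y in α..x, g y i := by
    rw [← Measure.restrict_congr_set Ioo_ae_eq_Icc]
    filter_upwards [hc, hfF] with x h1 h2
    rw [← h1, h2]
  -- Continuous functions that agree almost everywhere on `[α, β]` agree at every point; the value
  -- at `α` identifies `c`.
  have key := Measure.eqOn_Icc_of_ae_eq volume hαβ.ne hae hFi hcont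
  have h0 := key (left_mem_Icc.2 hαβ.le)
  simp only [intervalIntegral.integral_same, add_zero] at h0
  rw [h0]
  exact key hx

variable (hαβ : α < β) (ha : ∀ i, a i ≠ 0)

section

variable {T : C0Group (L2Interval α β n)}
  (hT : ∀ t f w, IsExtension a S f w → IsExtension a S (T.op t f) (charTranslate a w t))

include hαβ ha hT

/-- Time `r` carries the midpoint of the interval to `x₀`, so near `x₀` the function `w i` is a
translate of a component of `T.op r f`, which is in `L²` of a bounded interval. -/
theorem IsExtension.locallyIntegrable {f : L2Interval α β n} {w : Fin n → ℝ → ℂ}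
    (hw : IsExtension a S f w) (i : Fin n) : LocallyIntegrable (w i) := by
  intro x₀
  set r := (x₀ - (α + β) / 2) / a i with hr
  have hr' : a i * r = x₀ - (α + β) / 2 := mul_div_cancel₀ _ (ha i)
  have h1 : IntegrableOn (fun x => w i (x + a i * r)) (Ioo α β) :=
    (integrableOn_component (T.op r f) i).congr ((hT r f w hw).2 i)
  have h2 : IntegrableOn (w i) (Ioo (α + a i * r) (β + a i * r)) := by
    rw [← (measurePreserving_add_right volume (a i * r)).integrableOn_comp_preimage
      (MeasurableEquiv.addRight (a i * r)).measurableEmbedding]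
    simpa [Function.comp_def] using h1
  exact ⟨_, Ioo_mem_nhds (by rw [hr']; linarith) (by rw [hr']; linarith), h2⟩

/-! ### The domain of `L` lies in the domain of the generator -/

variable (hpos : IsUnit (S.toSquareBlockProp fun i => 0 < a i))
  (hneg : IsUnit (S.toSquareBlockProp fun i => ¬ 0 < a i))

include hpos hneg

/-- A function in the domain extends to a solution whose components are primitives of the
extension of its image. -/
theorem exists_primitive_extension {f h : L2Interval α β n} (hf : IsQuasiPeriodic S f)
    {g : L2Interval α β n} (hg : IsWeakDeriv f g) (hh : h = diagMul α β a g) :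
    ∃ V η, IsExtension a S f V ∧ IsExtension a S h η ∧ ∀ i x t,
      V i (x + a i * t) - V i x = ∫ r in (0:ℝ)..t, η i (x + a i * r) := by
  obtain ⟨F, hF, hfF, hFS⟩ := hf
  obtain ⟨η, hη⟩ := exists_isExtension hαβ ha hpos hneg h
  have hηi : ∀ i x y, IntervalIntegrable (fun y => (a i : ℂ)⁻¹ * η i y) volume x y := fun i x y =>
    (((hη.locallyIntegrable hαβ ha hT i).integrableOn_isCompact
      isCompact_uIcc).intervalIntegrable).const_mul _
  -- On `[α, β]` this is the continuous representative of `f`, because `h = A g`.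
  set V : Fin n → ℝ → ℂ := fun i x => F α i + ∫ y in α..x, (a i : ℂ)⁻¹ * η i y with hV
  have hinc : ∀ i x t, V i (x + a i * t) - V i x = ∫ r in (0:ℝ)..t, η i (x + a i * r) := by
    intro i x t
    rw [← integral_char_eq (ha i), hV]
    simp only [add_sub_add_left_eq_sub]
    rw [intervalIntegral.integral_interval_sub_left (hηi i _ _) (hηi i _ _)]
  have hgη : ∀ i, ∀ᵐ x ∂volume.restrict (Ioo α β), g x i = (a i : ℂ)⁻¹ * η i x := by
    intro i
    filter_upwards [hη.2 i, diagMul_component a g i] with x h1 h2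
    rw [← h1, hh, h2, inv_mul_cancel_left₀ (by exact_mod_cast ha i)]
  have hVF : ∀ i, ∀ x ∈ Icc α β, V i x = F x i := by
    intro i x hx
    rw [eqOn_primitive_of_isWeakDeriv hαβ hg hF hfF i hx, hV]
    simp only [add_right_inj]
    apply intervalIntegral.integral_congr_ae_restrict
    rw [uIoc_of_le hx.1]
    have hIoc : ∀ p : ℝ → Prop, (∀ᵐ x ∂volume.restrict (Ioo α β), p x) →
        ∀ᵐ x ∂volume.restrict (Ioc α β), p x := by
      intro p hp
      rwa [Measure.restrict_congr_set Ioo_ae_eq_Ioc] at hp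
    have := hIoc _ (hgη i)
    filter_upwards [ae_restrict_of_ae_restrict_of_subset (Ioc_subset_Ioc_right hx.2) this] with y hy
    exact hy.symm
  refine ⟨V, η, ⟨fun i t => ?_, fun i => ?_⟩, hη, hinc⟩
  -- At `t = 0` the boundary condition is that of `F`; the increments in `t` satisfy it because they
  -- are integrals of `η`, which does.
  · have h1 : V i (β + a i * t) = V i β + ∫ r in (0:ℝ)..t, η i (β + a i * r) := by
      rw [← hinc]; ring
    have h2 : ∀ j, V j (α + a j * t) = V j α + ∫ r in (0:ℝ)..t, η j (α + a j * r) := by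
      intro j
      rw [← hinc]; ring
    have h3 : V i β = ∑ j, S i j * V j α := by
      rw [hVF i β (right_mem_Icc.2 hαβ.le), hFS]
      simp_rw [fun j => hVF j α (left_mem_Icc.2 hαβ.le)]
      rfl
    have h4 : ∀ j, IntervalIntegrable (fun r => η j (α + a j * r)) volume 0 t := by
      intro j
      have h5 : IntervalIntegrable (η j) volume (α + 0) (α + a j * t) :=
        ((hη.locallyIntegrable hαβ ha hT j).integrableOn_isCompact
          isCompact_uIcc).intervalIntegrable
      have h6 := (h5.comp_add_left α).comp_mul_left (c := a j)
      simpa [ha j] using h6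
    rw [h1, h3]
    simp_rw [h2, mul_add, Finset.sum_add_distrib]
    congr 1
    simp_rw [hη.1 i]
    rw [intervalIntegral.integral_finsetSum fun j _ => (h4 j).const_mul _]
    simp_rw [intervalIntegral.integral_const_mul]
  · filter_upwards [hfF, ae_restrict_mem measurableSet_Ioo] with x h1 h2
    rw [h1, hVF i x (Ioo_subset_Icc_self h2)]

/-- The difference quotient is the average of `η` along the characteristic. For short times `η` may
be replaced by `W i h` in `L²(ℝ)`, whose averages converge to it. -/
theorem tendsto_quotient_of_mem_domain {f h : L2Interval α β n} (hf : IsQuasiPeriodic S f)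
    {g : L2Interval α β n} (hg : IsWeakDeriv f g) (hh : h = diagMul α β a g) :
    Tendsto (fun t : ℝ => (t : ℂ)⁻¹ • (T.op t f - f)) (𝓝[≠] 0) (𝓝 h) := by
  obtain ⟨V, η, hVf, hη, hinc⟩ := exists_primitive_extension hαβ ha hT hpos hneg hf hg hh
  obtain ⟨δ, hδ, W, hW⟩ := exists_window_clm hαβ ha hpos hneg
  apply tendsto_of_tendsto_component
  intro i
  have hlim : Tendsto (fun t : ℝ => a i * t) (𝓝[≠] 0) (𝓝[≠] 0) := by
    refine tendsto_nhdsWithin_iff.2 ⟨?_, ?_⟩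
    · exact ((by simpa using (continuous_const_mul (a i)).tendsto 0 :
        Tendsto (fun t : ℝ => a i * t) (𝓝 0) (𝓝 0))).mono_left nhdsWithin_le_nhds
    · filter_upwards [self_mem_nhdsWithin] with t ht
      exact mul_ne_zero (ha i) ht
  have h1 := (tendsto_eLpNorm_average_sub (Lp.memLp (W i h))).comp hlim
  have hnear : ∀ᶠ t : ℝ in 𝓝[≠] 0, |t| ≤ δ := by
    apply eventually_nhdsWithin_of_eventually_nhds
    filter_upwards [Metric.ball_mem_nhds (0 : ℝ) hδ] with t ht
    simpa using (Metric.mem_ball.1 ht).le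
  refine tendsto_of_tendsto_of_tendsto_of_le_of_le' tendsto_const_nhds h1
    (Eventually.of_forall fun _ => zero_le) ?_
  filter_upwards [hnear] with t ht
  refine le_trans (le_of_eq (eLpNorm_congr_ae ?_)) (eLpNorm_restrict_le _ 2 volume (Ioo α β))
  have hWη := hW h η hη i
  filter_upwards [(hT t f V hVf).2 i, hVf.2 i, hη.2 i, ae_restrict_of_ae hWη,
    Lp.coeFn_smul (t : ℂ)⁻¹ (T.op t f - f), Lp.coeFn_sub (T.op t f) f,
    ae_restrict_mem measurableSet_Ioo] with x k1 k2 k3 k4 k5 k6 hx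
  have e1 : ∫ r in (0:ℝ)..t, η i (x + a i * r) = ∫ r in (0:ℝ)..t, W i h (x + a i * r) := by
    apply intervalIntegral.integral_congr_ae
    have := (quasiMeasurePreserving_affine (ha i) x).ae hWη
    filter_upwards [this] with r hr hrt
    have habs : |r| ≤ δ := by
      refine le_trans ?_ ht
      simp only [uIoc, mem_Ioc] at hrt
      rcases le_total 0 t with h | h
      · rw [min_eq_left h, max_eq_right h] at hrt
        rw [abs_of_pos hrt.1, abs_of_nonneg h]
        exact hrt.2
      · rw [min_eq_right h, max_eq_left h] at hrt
        rw [abs_of_nonpos hrt.2, abs_of_nonpos h]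
        linarith [hrt.1]
    have := hr x hx r habs (add_comm _ _)
    rw [add_comm, this]
  have e2 : W i h x = η i x := k4 x hx 0 (by simpa using hδ.le) (by simp)
  rw [k5, Pi.smul_apply, k6, Pi.sub_apply, PiLp.smul_apply, PiLp.sub_apply, k1, k2, k3, e2]
  simp only [charTranslate]
  rw [hinc, e1, ← average_char_eq (ha i), ← Complex.ofReal_inv, Complex.coe_smul]

/-! ### The domain of the generator lies in the domain of `L` -/

omit hαβ hpos hneg in
-- Applying `T.op r` to the limit moves the convergence from `(α, β)` to its translate by `a i * r`.
-- The time step `τ / a i` produces the space step `τ`, and on a bounded interval `L²` convergence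
-- implies `L¹` convergence.
theorem tendsto_component_quotient {f h : L2Interval α β n}
    (hlim : Tendsto (fun t : ℝ => (t : ℂ)⁻¹ • (T.op t f - f)) (𝓝[≠] 0) (𝓝 h))
    {w η : Fin n → ℝ → ℂ} (hw : IsExtension a S f w) (hη : IsExtension a S h η) (i : Fin n)
    (r : ℝ) :
    Tendsto (fun τ : ℝ => ∫⁻ x in Ioo (α + a i * r) (β + a i * r),
      ‖τ⁻¹ • (w i (x + τ) - w i x) - (a i : ℂ)⁻¹ * η i x‖ₑ) (𝓝[≠] 0) (𝓝 0) := by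
  have h1 := tendsto_component (((T.op r).continuous.tendsto h).comp hlim) i
  have hdiv : Tendsto (fun τ : ℝ => τ / a i) (𝓝[≠] 0) (𝓝[≠] 0) := by
    refine tendsto_nhdsWithin_iff.2 ⟨?_, ?_⟩
    · exact ((by simpa using (continuous_id.div_const (a i)).tendsto 0 :
        Tendsto (fun τ : ℝ => τ / a i) (𝓝 0) (𝓝 0))).mono_left nhdsWithin_le_nhds
    · filter_upwards [self_mem_nhdsWithin] with t ht
      exact div_ne_zero ht (ha i)
  have h2 := h1.comp hdiv
  have hC : ‖(a i : ℂ)⁻¹‖ₑ * (volume.restrict (Ioo α β)) univ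
      ^ (1 / (1 : ENNReal).toReal - 1 / (2 : ENNReal).toReal) ≠ ⊤ :=
    ENNReal.mul_ne_top enorm_ne_top (ENNReal.rpow_ne_top_of_nonneg (by norm_num) (by simp))
  have h3 := ENNReal.Tendsto.const_mul h2 (Or.inr hC)
  rw [mul_zero] at h3
  refine tendsto_of_tendsto_of_tendsto_of_le_of_le tendsto_const_nhds h3 (fun _ => zero_le)
    fun τ => ?_
  simp only [Function.comp_apply]
  set D := T.op r (((τ / a i : ℝ) : ℂ)⁻¹ • (T.op (τ / a i) f - f)) with hD
  have hDw : ∀ᵐ x ∂volume.restrict (Ioo α β),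
      τ⁻¹ • (w i (x + a i * r + τ) - w i (x + a i * r)) - (a i : ℂ)⁻¹ * η i (x + a i * r)
        = (a i : ℂ)⁻¹ * (D x i - T.op r h x i) := by
    have e : D = ((τ / a i : ℝ) : ℂ)⁻¹ • (T.op (r + τ / a i) f - T.op r f) := by
      rw [hD, map_smul, map_sub, T.op_add]
      rfl
    rw [e]
    filter_upwards [Lp.coeFn_smul ((τ / a i : ℝ) : ℂ)⁻¹ (T.op (r + τ / a i) f - T.op r f),
      Lp.coeFn_sub (T.op (r + τ / a i) f) (T.op r f), (hT (r + τ / a i) f w hw).2 i,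
      (hT r f w hw).2 i, (hT r h η hη).2 i] with x k1 k2 k3 k4 k5
    rw [k1, Pi.smul_apply, k2, Pi.sub_apply, PiLp.smul_apply, PiLp.sub_apply, k3, k4, k5]
    have hai := ha i
    have hai' : (a i : ℂ) ≠ 0 := by exact_mod_cast hai
    have e1 : x + a i * (r + τ / a i) = x + a i * r + τ := by
      rw [mul_add, mul_div_cancel₀ _ hai, add_assoc]
    simp only [charTranslate, e1, smul_eq_mul, Complex.real_smul]
    push_cast
    have e2 : (a i : ℂ)⁻¹ * ((τ : ℂ) / a i)⁻¹ = (τ : ℂ)⁻¹ := by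
      rw [inv_div, div_eq_mul_inv, inv_mul_cancel_left₀ hai']
    linear_combination -(w i (x + a i * r + τ) - w i (x + a i * r)) * e2
  have hmeas : AEStronglyMeasurable (fun x => D x i - T.op r h x i) (volume.restrict (Ioo α β)) :=
    (aestronglyMeasurable_component _ i).sub (aestronglyMeasurable_component _ i)
  calc ∫⁻ x in Ioo (α + a i * r) (β + a i * r),
        ‖τ⁻¹ • (w i (x + τ) - w i x) - (a i : ℂ)⁻¹ * η i x‖ₑ
      = ∫⁻ x in Ioo α β, ‖τ⁻¹ • (w i (x + a i * r + τ) - w i (x + a i * r))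
          - (a i : ℂ)⁻¹ * η i (x + a i * r)‖ₑ := by
        rw [← (measurePreserving_add_right volume (a i * r)).setLIntegral_comp_preimage_emb
          (MeasurableEquiv.addRight (a i * r)).measurableEmbedding]
        simp
    _ = ∫⁻ x in Ioo α β, ‖(a i : ℂ)⁻¹‖ₑ * ‖D x i - T.op r h x i‖ₑ := by
        apply lintegral_congr_ae
        filter_upwards [hDw] with x hx
        rw [hx, enorm_mul]
    _ = ‖(a i : ℂ)⁻¹‖ₑ * eLpNorm (fun x => D x i - T.op r h x i) 1
          (volume.restrict (Ioo α β)) := by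
        rw [lintegral_const_mul' _ _ enorm_ne_top, eLpNorm_one_eq_lintegral_enorm]
    _ ≤ _ := by
        rw [mul_assoc, mul_comm (_ ^ _)]
        gcongr
        exact eLpNorm_le_eLpNorm_mul_rpow_measure_univ (by norm_num) hmeas

omit hpos hneg in
/-- If the orbit of `f` is differentiable with derivative `h`, then the extension of `h` is, up to
the speeds, the weak derivative of the extension of `f`. -/
theorem integral_deriv_smul_extension {f h : L2Interval α β n}
    (hlim : Tendsto (fun t : ℝ => (t : ℂ)⁻¹ • (T.op t f - f)) (𝓝[≠] 0) (𝓝 h))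
    {w η : Fin n → ℝ → ℂ} (hw : IsExtension a S f w) (hη : IsExtension a S h η) (i : Fin n)
    {φ : ℝ → ℝ} (hφ : ContDiff ℝ ∞ φ) (hc : HasCompactSupport φ) :
    ∫ x, deriv φ x • w i x = - ∫ x, φ x • ((a i : ℂ)⁻¹ * η i x) := by
  refine integral_deriv_smul_of_tendsto_quotient (hw.locallyIntegrable hαβ ha hT i)
    ((hη.locallyIntegrable hαβ ha hT i).smul (a i : ℂ)⁻¹) (fun K hK => ?_) hφ hc
  -- The translates of `(α, β)` by `a i * r` cover the line, so finitely many cover `K`.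
  refine hK.induction_on (p := fun K => Tendsto (fun τ : ℝ => ∫⁻ x in K,
    ‖τ⁻¹ • (w i (x + τ) - w i x) - (a i : ℂ)⁻¹ * η i x‖ₑ) (𝓝[≠] 0) (𝓝 0)) ?_ ?_ ?_ ?_
  · simp
  · intro s t hst ht
    exact tendsto_of_tendsto_of_tendsto_of_le_of_le tendsto_const_nhds ht (fun _ => zero_le)
      fun τ => lintegral_mono_set hst
  · intro s t hs ht
    have := hs.add ht
    rw [add_zero] at this
    exact tendsto_of_tendsto_of_tendsto_of_le_of_le tendsto_const_nhds this (fun _ => zero_le)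
      fun τ => lintegral_union_le _ _ _
  · intro x₀ _
    set r := (x₀ - (α + β) / 2) / a i with hr
    have hr' : a i * r = x₀ - (α + β) / 2 := mul_div_cancel₀ _ (ha i)
    exact ⟨_, mem_nhdsWithin_of_mem_nhds
      (Ioo_mem_nhds (by rw [hr']; linarith) (by rw [hr']; linarith)),
      tendsto_component_quotient ha hT hlim hw hη i r⟩

/-- The weak derivative is used on an interval containing `α` and `β` in its interior. There `w i`
has a continuous representative `V i`, which inherits the boundary condition at almost every small
time and, by continuity, at time zero. -/
theorem isQuasiPeriodic_of_tendsto {f h : L2Interval α β n}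
    (hlim : Tendsto (fun t : ℝ => (t : ℂ)⁻¹ • (T.op t f - f)) (𝓝[≠] 0) (𝓝 h)) :
    IsQuasiPeriodic S f := by
  obtain ⟨w, hw⟩ := exists_isExtension hαβ ha hpos hneg f
  obtain ⟨η, hη⟩ := exists_isExtension hαβ ha hpos hneg h
  set u : Fin n → ℝ → ℂ := fun i x => (a i : ℂ)⁻¹ * η i x with hu
  have hul : ∀ i, LocallyIntegrable (u i) := fun i =>
    (hη.locallyIntegrable hαβ ha hT i).smul (a i : ℂ)⁻¹
  have hIoo : ∀ {v : ℝ → ℂ}, LocallyIntegrable v → IntegrableOn v (Ioo (α - 1) (β + 1)) :=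
    fun hv => (hv.integrableOn_isCompact isCompact_Icc).mono_set Ioo_subset_Icc_self
  have hrep : ∀ i, ∃ c : ℂ, ∀ᵐ x ∂volume.restrict (Ioo (α - 1) (β + 1)),
      w i x = c + ∫ y in (α - 1)..x, u i y := by
    intro i
    refine ae_eq_const_add_primitive (by linarith) (hIoo (hw.locallyIntegrable hαβ ha hT i))
      (hIoo (hul i)) fun φ h1 h2 h3 => ?_
    have h0 : ∀ x, x ∉ Ioo (α - 1) (β + 1) → φ x = 0 := fun x hx =>
      image_eq_zero_of_notMem_tsupport fun hx' => hx (h3 hx')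
    have h0' : ∀ x, x ∉ Ioo (α - 1) (β + 1) → deriv φ x = 0 := fun x hx =>
      image_eq_zero_of_notMem_tsupport fun hx' => hx (h3 (tsupport_deriv_subset hx'))
    rw [setIntegral_eq_integral_of_forall_compl_eq_zero fun x hx => by rw [h0' x hx, zero_smul],
      setIntegral_eq_integral_of_forall_compl_eq_zero fun x hx => by rw [h0 x hx, zero_smul]]
    exact integral_deriv_smul_extension hαβ ha hT hlim hw hη i h1 h2
  choose c hc using hrep
  set V : Fin n → ℝ → ℂ := fun i x => c i + ∫ y in (α - 1)..x, u i y with hV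
  have hVc : ∀ i, Continuous (V i) := fun i => continuous_const.add
    (intervalIntegral.continuous_primitive (fun p q =>
      ((hul i).integrableOn_isCompact isCompact_uIcc).intervalIntegrable) _)
  have hwV : ∀ i, ∀ᵐ x, x ∈ Ioo (α - 1) (β + 1) → w i x = V i x := fun i =>
    (ae_restrict_iff' measurableSet_Ioo).1 (hc i)
  -- Times up to `ρ` move points of `[α, β]` by less than one. The summand `1` makes this strict and
  -- keeps the denominator positive when `n = 0`.
  obtain ⟨ρ, hρ, hρa⟩ : ∃ ρ > 0, ∀ i, |a i| * ρ < 1 := by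
    have hs : 0 < 1 + ∑ j, |a j| := by positivity
    refine ⟨(1 + ∑ j, |a j|)⁻¹, inv_pos.2 hs, fun i => ?_⟩
    rw [← div_eq_mul_inv, div_lt_one hs]
    have := Finset.single_le_sum (f := fun j => |a j|) (fun j _ => abs_nonneg _)
      (Finset.mem_univ i)
    linarith
  have hmem : ∀ i, ∀ x ∈ Icc α β, ∀ t ∈ Icc (-ρ) ρ, a i * t + x ∈ Ioo (α - 1) (β + 1) := by
    intro i x hx t ht
    have h1 : |a i * t| < 1 := by
      rw [abs_mul]
      exact (mul_le_mul_of_nonneg_left (abs_le.2 ht) (abs_nonneg _)).trans_lt (hρa i)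
    have h2 := abs_lt.1 h1
    exact ⟨by linarith [hx.1], by linarith [hx.2]⟩
  have hbc : ∀ i, V i β = ∑ j, S i j * V j α := by
    intro i
    have hae : (fun t => V i (a i * t + β)) =ᵐ[volume.restrict (Icc (-ρ) ρ)]
        fun t => ∑ j, S i j * V j (a j * t + α) := by
      have k1 := (quasiMeasurePreserving_affine (ha i) β).ae (hwV i)
      have k2 : ∀ᵐ t, ∀ j, a j * t + α ∈ Ioo (α - 1) (β + 1) →
          w j (a j * t + α) = V j (a j * t + α) :=
        ae_all_iff.2 fun j => (quasiMeasurePreserving_affine (ha j) α).ae (hwV j)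
      filter_upwards [ae_restrict_of_ae k1, ae_restrict_of_ae k2,
        ae_restrict_mem measurableSet_Icc] with t h1 h2 ht
      rw [← h1 (hmem i β (right_mem_Icc.2 hαβ.le) t ht), add_comm, hw.1 i t]
      apply Finset.sum_congr rfl
      intro j _
      rw [← h2 j (hmem j α (left_mem_Icc.2 hαβ.le) t ht), add_comm]
    have key := Measure.eqOn_Icc_of_ae_eq volume (by linarith : -ρ ≠ ρ) hae
      (((hVc i).comp (by fun_prop)).continuousOn)
      ((continuous_finsetSum _ fun j _ =>
        continuous_const.mul ((hVc j).comp (by fun_prop))).continuousOn)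
    simpa using key (show (0 : ℝ) ∈ Icc (-ρ) ρ from ⟨by linarith, hρ.le⟩)
  refine ⟨fun x => WithLp.toLp 2 fun i => V i x, ?_, ?_, ?_⟩
  · exact ((PiLp.continuous_toLp 2 _).comp (continuous_pi hVc)).continuousOn
  · filter_upwards [ae_all_iff.2 hw.2, ae_restrict_of_ae (ae_all_iff.2 hwV),
      ae_restrict_mem measurableSet_Ioo] with x h1 h2 hx
    ext i
    rw [h1, h2 i ⟨by linarith [hx.1], by linarith [hx.2]⟩]
  · ext i
    change V i β = _
    rw [hbc]
    rfl

/-- Test functions supported in `(α, β)` see the extensions only where these coincide with `f` and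
`h`. -/
theorem isWeakDeriv_of_tendsto {f h : L2Interval α β n}
    (hlim : Tendsto (fun t : ℝ => (t : ℂ)⁻¹ • (T.op t f - f)) (𝓝[≠] 0) (𝓝 h)) :
    IsWeakDeriv f (diagMul α β (fun i => (a i)⁻¹) h) := by
  obtain ⟨w, hw⟩ := exists_isExtension hαβ ha hpos hneg f
  obtain ⟨η, hη⟩ := exists_isExtension hαβ ha hpos hneg h
  rw [isWeakDeriv_iff_component]
  intro i φ h1 h2 h3
  have h0 : ∀ x, x ∉ Ioo α β → φ x = 0 := fun x hx =>
    image_eq_zero_of_notMem_tsupport fun hx' => hx (h3 hx')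
  have h0' : ∀ x, x ∉ Ioo α β → deriv φ x = 0 := fun x hx =>
    image_eq_zero_of_notMem_tsupport fun hx' => hx (h3 (tsupport_deriv_subset hx'))
  have e1 : ∫ x in Ioo α β, deriv φ x • f x i = ∫ x in Ioo α β, deriv φ x • w i x := by
    apply integral_congr_ae
    filter_upwards [hw.2 i] with x hx
    rw [hx]
  have e2 : ∫ x in Ioo α β, φ x • diagMul α β (fun i => (a i)⁻¹) h x i
      = ∫ x in Ioo α β, φ x • ((a i : ℂ)⁻¹ * η i x) := by
    apply integral_congr_ae
    filter_upwards [hη.2 i, diagMul_component (fun i => (a i)⁻¹) h i] with x h1 h2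
    rw [h2, h1, Complex.ofReal_inv]
  rw [e1, e2,
    setIntegral_eq_integral_of_forall_compl_eq_zero fun x hx => by rw [h0' x hx, zero_smul],
    setIntegral_eq_integral_of_forall_compl_eq_zero fun x hx => by rw [h0 x hx, zero_smul]]
  exact integral_deriv_smul_extension hαβ ha hT hlim hw hη i h1 h2

theorem generator_eq : T.generator = quasiPeriodicOperator α β a S := by
  apply LinearPMap.eq_of_eq_graph
  ext ⟨f, h⟩
  rw [C0Group.mem_graph_generator, mem_graph_quasiPeriodicOperator]
  constructor
  · intro hlim
    refine ⟨isQuasiPeriodic_of_tendsto hαβ ha hT hpos hneg hlim, _,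
      isWeakDeriv_of_tendsto hαβ ha hT hpos hneg hlim, ?_⟩
    apply Lp.ext
    filter_upwards [ae_all_iff.2 (diagMul_component a (diagMul α β (fun i => (a i)⁻¹) h)),
      ae_all_iff.2 (diagMul_component (fun i => (a i)⁻¹) h)] with x h1 h2
    ext i
    rw [h1, h2, Complex.ofReal_inv, mul_inv_cancel_left₀ (by exact_mod_cast ha i)]
  · rintro ⟨hf, g, hg, hh⟩
    exact tendsto_quotient_of_mem_domain hαβ ha hT hpos hneg hf hg hh

end

end Generator

end

theorem theorem32 (α β : ℝ) (hαβ : α < β) (n : ℕ) (a : Fin n → ℝ) (ha : ∀ i, a i ≠ 0)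
    (S : Matrix (Fin n) (Fin n) ℂ) (hS : IsUnit S)
    (hpos : IsUnit (S.toSquareBlockProp fun i => 0 < a i))
    (hneg : IsUnit (S.toSquareBlockProp fun i => a i < 0)) :
    ∃ T : C0Group (L2Interval α β n), T.generator = quasiPeriodicOperator α β a S := by
  have hneg' : IsUnit (S.toSquareBlockProp fun i => ¬ 0 < a i) := by
    rw [Matrix.isUnit_iff_isUnit_det] at hneg ⊢
    rwa [Matrix.equiv_block_det S (q := fun i => a i < 0) fun i =>
      ⟨fun h => h.not_gt, fun h => (ha i).lt_or_gt.resolve_right h⟩]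
  obtain ⟨T, hT⟩ := exists_group hαβ ha hpos hneg'
  exact ⟨T, generator_eq hαβ ha hT hpos hneg'⟩
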